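/- **Conventions.** A net means a family $(u_\varepsilon)_{\varepsilon\in(0,1]}$. A net of smooth maps $u_\varepsilon:\mathbb R^m\to\mathbb R^k$ is *moderate* if for every compact $K$ and every $j\in\mathbb N_0$ there is $N\in\mathbb N$ with $\sup_{x\in K}\|D^{j}u_\varepsilon(x)\|=O(\varepsilon^{-N})$ as $\varepsilon\to0$, and *c-bounded* if for every compact $K\subset\mathbb R^m$ there are $\varepsilon_0>0$ and a compact $K'\subset\mathbb R^k$ with $u_\varepsilon(K)\subseteq K'$ for all $\varepsilon<\varepsilon_0$. - $\mathcal G(\mathbb R^m)^k$ is the space of moderate nets modulo the nets with $\sup_{x\in K}|u_\varepsilon(x)|=O(\varepsilon^q)$ for all compact $K$ and all $q\in\mathbb N_0$. - $\mathcal G[\mathbb R^m,\mathbb R^k]$ is the space of moderate c-bounded nets modulo the relation $(u_\varepsilon)\sim(v_\varepsilon)$ iff $\sup_{x\in K}\|D^{j}(u_\varepsilon-v_\varepsilon)(x)\|=O(\varepsilon^q)$ for all compact $K$ and all $j,q\in\mathbb N_0$. It embeds canonically into $\mathcal G(\mathbb R^m)^k$; an element of $\mathcal G(\mathbb R^m)^k$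 is called c-bounded if it lies in $\mathcal G[\mathbb R^m,\mathbb R^k]$. Derivatives, and compositions whose inner factor is c-bounded, are defined on representatives; smooth maps are regarded as constant nets. **Theorem 3.3.** Let $n\in\mathbb N_0$ and let $F\in\mathcal G(\mathbb R^n)^n$ have a representative $(F_\varepsilon)_\varepsilon$ such that 1. there are $C,\varepsilon_0>0$ with $|F_\varepsilon(x)|\le C(1+|x|)$ for all $x\in\mathbb R^n$ and all $\varepsilon<\varepsilon_0$; 2. for every compact $K\subset\mathbb R^n$, $\sup_{x\in K}|\nabla F_\varepsilon(x)|=O(|\log\varepsilon|)$ as $\varepsilon\to0$. Then there is a unique $\Phi\in\mathcal G[\mathbb R^{1+n},\mathbb R^n]$ (the generalized flow of $\dot x=F(x)$) such that $$\frac{d}{dt}\Phi(t,x)=F(\Phi(t,x))\ \text{ in }\mathcal G[\mathbb R^{1+n},\mathbb R^n],\qquad \Phi(0,\cdot)=\mathrm{id}_{\mathbb R^n}\ \text{ in }\mathcal G[\mathbb R^n,\mathbb R^n],$$ $$\Phi(t+s,\cdot)=\Phi(t,\Phi(s,\cdot))\ \text{ in }\mathcal G[\mathbb R^{2+n},\mathbb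 R^n].$$ Moreover, $\frac{d}{dt}\Phi$ is c-bounded. If, in addition, $F$ has a representative $(F_\varepsilon)_\varepsilon$ for which there are $C,\varepsilon_0>0$ with $|F_\varepsilon(0)|\le C$ and $|\nabla F_\varepsilon(x)|\le C$ for all $x\in\mathbb R^n$ and all $\varepsilon<\varepsilon_0$, then $\nabla_x\Phi$ is c-bounded as well. -/

import Mathlib

open scoped ContDiff Topology
open Filter

set_option linter.unusedSectionVars false

namespace Colombeau

/-- The parameter interval `I = (0, 1]`. -/
abbrev Eps : Type := Set.Ioc (0 : ℝ) 1

/-- The filter of neighbourhoods of `0` in `(0, 1]`: a property holds eventually along it iff there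
is `ε₀ > 0` such that it holds for all `ε < ε₀`. -/
def smallEps : Filter Eps := comap (fun ε : Eps => (ε : ℝ)) (𝓝 0)

theorem eventually_smallEps {p : Eps → Prop} :
    (∀ᶠ ε in smallEps, p ε) ↔ ∃ ε₀ > (0 : ℝ), ∀ ε : Eps, (ε : ℝ) < ε₀ → p ε := by
  unfold smallEps
  rw [eventually_comap, Metric.eventually_nhds_iff]
  constructor
  · rintro ⟨e, he, h⟩
    refine ⟨e, he, fun ε hε => h (y := (ε : ℝ)) ?_ ε rfl⟩
    rw [Real.dist_eq, sub_zero, abs_of_pos ε.2.1]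
    exact hε
  · rintro ⟨e, he, h⟩
    refine ⟨e, he, fun y hy ε hεy => h ε ?_⟩
    rw [Real.dist_eq, sub_zero] at hy
    rw [hεy]
    exact lt_of_le_of_lt (le_abs_self y) hy

section Nets

variable {X Y Z W : Type*}
  [NormedAddCommGroup X] [NormedSpace ℝ X]
  [NormedAddCommGroup Y] [NormedSpace ℝ Y]
  [NormedAddCommGroup Z] [NormedSpace ℝ Z]
  [NormedAddCommGroup W] [NormedSpace ℝ W]

/-- Moderate nets of smooth maps: on every compact set the derivatives of each order
are `O(ε ^ (-N))` for some `N`. -/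
structure IsModerate (u : Eps → X → Y) : Prop where
  smooth : ∀ ε, ContDiff ℝ ∞ (u ε)
  moderate : ∀ K : Set X, IsCompact K → ∀ k : ℕ, ∃ N : ℕ, ∃ C : ℝ,
    ∀ᶠ ε in smallEps, ∀ x ∈ K, ‖iteratedFDeriv ℝ k (u ε) x‖ ≤ C * ((ε : ℝ) ^ N)⁻¹

/-- The estimates of negligible nets: on every compact set the net is `O(ε ^ m)` for all `m`. -/
def IsNegligible (u : Eps → X → Y) : Prop :=
  ∀ K : Set X, IsCompact K → ∀ m : ℕ, ∃ C : ℝ,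
    ∀ᶠ ε in smallEps, ∀ x ∈ K, ‖u ε x‖ ≤ C * (ε : ℝ) ^ m

/-- The estimates of negligible nets for the derivatives of all orders. -/
def IsNegligibleAllOrders (u : Eps → X → Y) : Prop :=
  ∀ k : ℕ, ∀ K : Set X, IsCompact K → ∀ m : ℕ, ∃ C : ℝ,
    ∀ᶠ ε in smallEps, ∀ x ∈ K, ‖iteratedFDeriv ℝ k (u ε) x‖ ≤ C * (ε : ℝ) ^ m

/-- Compactly bounded (c-bounded) nets. -/
def IsCBoundedNet (u : Eps → X → Y) : Prop :=
  ∀ K : Set X, IsCompact K → ∃ K' : Set Y, IsCompact K' ∧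
    ∀ᶠ ε in smallEps, ∀ x ∈ K, u ε x ∈ K'

/-! ### Estimates needed to define operations on classes of nets -/

theorem IsNegligible.add {u v : Eps → X → Y} (hu : IsNegligible u) (hv : IsNegligible v) :
    IsNegligible (fun ε x => u ε x + v ε x) := by
  intro K hK m
  obtain ⟨C, hC⟩ := hu K hK m
  obtain ⟨D, hD⟩ := hv K hK m
  refine ⟨C + D, ?_⟩
  filter_upwards [hC, hD] with ε h1 h2 x hx
  calc ‖u ε x + v ε x‖ ≤ ‖u ε x‖ + ‖v ε x‖ := norm_add_le _ _
    _ ≤ C * (ε : ℝ) ^ m + D * (ε : ℝ) ^ m := add_le_add (h1 x hx) (h2 x hx)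
    _ = (C + D) * (ε : ℝ) ^ m := by ring

theorem IsNegligible.symm {u v : Eps → X → Y} (h : IsNegligible (fun ε x => u ε x - v ε x)) :
    IsNegligible (fun ε x => v ε x - u ε x) := by
  intro K hK m
  obtain ⟨C, hC⟩ := h K hK m
  refine ⟨C, ?_⟩
  filter_upwards [hC] with ε h1 x hx
  rw [norm_sub_rev]
  exact h1 x hx

theorem IsNegligible.refl (u : Eps → X → Y) : IsNegligible (fun ε x => u ε x - u ε x) := by
  intro K _ m
  refine ⟨0, Eventually.of_forall fun ε x _ => ?_⟩
  simp

theorem IsNegligible.trans {u v w : Eps → X → Y} (h1 : IsNegligible (fun ε x => u ε x - v ε x))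
    (h2 : IsNegligible (fun ε x => v ε x - w ε x)) :
    IsNegligible (fun ε x => u ε x - w ε x) := by
  have h := h1.add h2
  simpa using h

theorem IsModerate.sub {u v : Eps → X → Y} (hu : IsModerate u) (hv : IsModerate v) :
    IsModerate (fun ε x => u ε x - v ε x) := by
  refine ⟨fun ε => (hu.smooth ε).sub (hv.smooth ε), fun K hK k => ?_⟩
  obtain ⟨N, C, hC⟩ := hu.moderate K hK k
  obtain ⟨M, D, hD⟩ := hv.moderate K hK k
  refine ⟨N + M, |C| + |D|, ?_⟩
  filter_upwards [hC, hD] with ε h1 h2 x hx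
  have e0 : (0 : ℝ) < ε := ε.2.1
  have e1 : (ε : ℝ) ≤ 1 := ε.2.2
  have hs : iteratedFDeriv ℝ k (fun x => u ε x - v ε x) x
      = iteratedFDeriv ℝ k (u ε) x - iteratedFDeriv ℝ k (v ε) x := by
    have ha : ContDiffAt ℝ k (u ε) x := ((hu.smooth ε).of_le (by exact_mod_cast le_top)).contDiffAt
    have hb : ContDiffAt ℝ k (v ε) x := ((hv.smooth ε).of_le (by exact_mod_cast le_top)).contDiffAt
    exact iteratedFDeriv_sub_apply ha hb
  rw [hs]
  have p1 : ((ε : ℝ) ^ N)⁻¹ ≤ ((ε : ℝ) ^ (N + M))⁻¹ :=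
    inv_anti₀ (by positivity) (pow_le_pow_of_le_one e0.le e1 (by omega))
  have p2 : ((ε : ℝ) ^ M)⁻¹ ≤ ((ε : ℝ) ^ (N + M))⁻¹ :=
    inv_anti₀ (by positivity) (pow_le_pow_of_le_one e0.le e1 (by omega))
  calc _ ≤ ‖iteratedFDeriv ℝ k (u ε) x‖ + ‖iteratedFDeriv ℝ k (v ε) x‖ := norm_sub_le _ _
    _ ≤ |C| * ((ε : ℝ) ^ N)⁻¹ + |D| * ((ε : ℝ) ^ M)⁻¹ := by
        refine add_le_add ((h1 x hx).trans ?_) ((h2 x hx).trans ?_)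
        · gcongr; exact le_abs_self C
        · gcongr; exact le_abs_self D
    _ ≤ |C| * ((ε : ℝ) ^ (N + M))⁻¹ + |D| * ((ε : ℝ) ^ (N + M))⁻¹ := by gcongr
    _ = _ := by ring

theorem IsModerate.uniform {u : Eps → X → Y} (hu : IsModerate u) {K : Set X} (hK : IsCompact K)
    (n : ℕ) : ∃ N : ℕ, ∃ C : ℝ, 1 ≤ C ∧ ∀ᶠ ε in smallEps, ∀ k ≤ n, ∀ x ∈ K,
      ‖iteratedFDeriv ℝ k (u ε) x‖ ≤ C * ((ε : ℝ) ^ N)⁻¹ := by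
  have h : ∀ k : ℕ, ∃ N : ℕ, ∃ C : ℝ, ∀ᶠ ε in smallEps, ∀ x ∈ K,
      ‖iteratedFDeriv ℝ k (u ε) x‖ ≤ C * ((ε : ℝ) ^ N)⁻¹ := fun k => hu.moderate K hK k
  choose N C hC using h
  refine ⟨∑ k ∈ Finset.range (n + 1), N k, 1 + ∑ k ∈ Finset.range (n + 1), |C k|,
    le_add_of_nonneg_right (Finset.sum_nonneg fun _ _ => abs_nonneg _), ?_⟩
  have hall : ∀ᶠ ε in smallEps, ∀ k ∈ Finset.range (n + 1), ∀ x ∈ K,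
      ‖iteratedFDeriv ℝ k (u ε) x‖ ≤ C k * ((ε : ℝ) ^ N k)⁻¹ := by
    rw [eventually_all_finset]
    exact fun k _ => hC k
  filter_upwards [hall] with ε h k hk x hx
  have hk' : k ∈ Finset.range (n + 1) := Finset.mem_range.2 (by omega)
  have e0 : (0 : ℝ) < ε := ε.2.1
  have e1 : (ε : ℝ) ≤ 1 := ε.2.2
  have p1 : ((ε : ℝ) ^ N k)⁻¹ ≤ ((ε : ℝ) ^ (∑ k ∈ Finset.range (n + 1), N k))⁻¹ :=
    inv_anti₀ (by positivity) (pow_le_pow_of_le_one e0.le e1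
      (Finset.single_le_sum (f := N) (fun _ _ => Nat.zero_le _) hk'))
  have p2 : |C k| ≤ ∑ k ∈ Finset.range (n + 1), |C k| :=
    Finset.single_le_sum (f := fun k => |C k|) (fun _ _ => abs_nonneg _) hk'
  have p3 : C k ≤ 1 + ∑ k ∈ Finset.range (n + 1), |C k| := by
    linarith [le_abs_self (C k)]
  have p4 : (0 : ℝ) ≤ 1 + ∑ k ∈ Finset.range (n + 1), |C k| := by
    linarith [abs_nonneg (C k)]
  calc _ ≤ C k * ((ε : ℝ) ^ N k)⁻¹ := h k hk' x hx
    _ ≤ (1 + ∑ k ∈ Finset.range (n + 1), |C k|) * ((ε : ℝ) ^ N k)⁻¹ := by gcongr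
    _ ≤ _ := by gcongr

theorem IsModerate.fderiv {u : Eps → X → Y} (hu : IsModerate u) :
    IsModerate (fun ε => fderiv ℝ (u ε)) := by
  refine ⟨fun ε => (hu.smooth ε).fderiv_right (by norm_cast), fun K hK k => ?_⟩
  obtain ⟨N, C, hC⟩ := hu.moderate K hK (k + 1)
  refine ⟨N, C, ?_⟩
  filter_upwards [hC] with ε h x hx
  rw [norm_iteratedFDeriv_fderiv]
  exact h x hx

theorem IsModerate.clm {u : Eps → X → Y} (hu : IsModerate u) (L : Y →L[ℝ] Z) :
    IsModerate (fun ε x => L (u ε x)) := by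
  refine ⟨fun ε => L.contDiff.comp (hu.smooth ε), fun K hK k => ?_⟩
  obtain ⟨N, C, hC⟩ := hu.moderate K hK k
  refine ⟨N, ‖L‖ * C, ?_⟩
  filter_upwards [hC] with ε h x hx
  calc _ ≤ ‖L‖ * ‖iteratedFDeriv ℝ k (u ε) x‖ :=
        L.norm_iteratedFDeriv_comp_left (hu.smooth ε).contDiffAt
          (by exact_mod_cast le_top)
    _ ≤ ‖L‖ * (C * ((ε : ℝ) ^ N)⁻¹) := by gcongr; exact h x hx
    _ = _ := by ring

theorem IsNegligible.clm {u v : Eps → X → Y} (h : IsNegligible (fun ε x => u ε x - v ε x))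
    (L : Y →L[ℝ] Z) : IsNegligible (fun ε x => L (u ε x) - L (v ε x)) := by
  intro K hK m
  obtain ⟨C, hC⟩ := h K hK m
  refine ⟨‖L‖ * C, ?_⟩
  filter_upwards [hC] with ε h x hx
  rw [← map_sub]
  calc _ ≤ ‖L‖ * ‖u ε x - v ε x‖ := L.le_opNorm _
    _ ≤ ‖L‖ * (C * (ε : ℝ) ^ m) := by gcongr; exact h x hx
    _ = _ := by ring

theorem isModerate_const {f : X → Y} (hf : ContDiff ℝ ∞ f) :
    IsModerate (fun _ : Eps => f) := by
  refine ⟨fun _ => hf, fun K hK k => ?_⟩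
  have hc : Continuous (iteratedFDeriv ℝ k f) :=
    hf.continuous_iteratedFDeriv (by exact_mod_cast le_top)
  obtain ⟨C, hC⟩ := hK.exists_bound_of_continuousOn hc.continuousOn
  refine ⟨0, C, Eventually.of_forall fun ε x hx => ?_⟩
  simpa using hC x hx

theorem isCBoundedNet_const {f : X → Y} (hf : ContDiff ℝ ∞ f) :
    IsCBoundedNet (fun _ : Eps => f) := fun K hK =>
  ⟨f '' K, hK.image hf.continuous, Eventually.of_forall fun _ x hx => ⟨x, hx, rfl⟩⟩

theorem IsModerate.prodMk {u : Eps → X → Y} {v : Eps → X → Z} (hu : IsModerate u)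
    (hv : IsModerate v) : IsModerate (fun ε x => (u ε x, v ε x)) := by
  refine ⟨fun ε => (hu.smooth ε).prodMk (hv.smooth ε), ?_⟩
  have h1 := hu.clm (ContinuousLinearMap.inl ℝ Y Z)
  have h2 := hv.clm (-(ContinuousLinearMap.inr ℝ Y Z))
  have h3 := (h1.sub h2).moderate
  simpa using h3

theorem IsCBoundedNet.prodMk {u : Eps → X → Y} {v : Eps → X → Z} (hu : IsCBoundedNet u)
    (hv : IsCBoundedNet v) : IsCBoundedNet (fun ε x => (u ε x, v ε x)) := by
  intro K hK
  obtain ⟨A, hA, hA'⟩ := hu K hK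
  obtain ⟨B, hB, hB'⟩ := hv K hK
  refine ⟨A ×ˢ B, hA.prod hB, ?_⟩
  filter_upwards [hA', hB'] with ε h1 h2 x hx
  exact ⟨h1 x hx, h2 x hx⟩

theorem IsNegligible.prodMk {u u' : Eps → X → Y} {v v' : Eps → X → Z}
    (hu : IsNegligible (fun ε x => u ε x - u' ε x))
    (hv : IsNegligible (fun ε x => v ε x - v' ε x)) :
    IsNegligible (fun ε x => (u ε x, v ε x) - (u' ε x, v' ε x)) := by
  have h1 := hu.clm (ContinuousLinearMap.inl ℝ Y Z)
  have h2 := hv.clm (ContinuousLinearMap.inr ℝ Y Z)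
  have h3 := h1.add h2
  simpa using h3

theorem IsModerate.comp {f : Eps → Y → Z} {u : Eps → X → Y} (hf : IsModerate f)
    (hu : IsModerate u) (hb : IsCBoundedNet u) : IsModerate (fun ε x => f ε (u ε x)) := by
  refine ⟨fun ε => (hf.smooth ε).comp (hu.smooth ε), fun K hK k => ?_⟩
  obtain ⟨K', hK', hm⟩ := hb K hK
  obtain ⟨N, C, hC1, hC⟩ := hf.uniform hK' k
  obtain ⟨M, D, hD1, hD⟩ := hu.uniform hK k
  refine ⟨N + M * k, k.factorial * C * D ^ k, ?_⟩
  filter_upwards [hm, hC, hD] with ε h0 h1 h2 x hx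
  have e0 : (0 : ℝ) < ε := ε.2.1
  have e1 : (ε : ℝ) ≤ 1 := ε.2.2
  have hge : 1 ≤ D * ((ε : ℝ) ^ M)⁻¹ :=
    one_le_mul_of_one_le_of_one_le hD1 ((one_le_inv₀ (by positivity)).2 (pow_le_one₀ e0.le e1))
  have key := norm_iteratedFDeriv_comp_le (n := k) (N := (∞ : WithTop ℕ∞)) (hf.smooth ε)
    (hu.smooth ε) (by exact_mod_cast le_top) x
    (C := C * ((ε : ℝ) ^ N)⁻¹) (D := D * ((ε : ℝ) ^ M)⁻¹)
    (fun i hi => h1 i hi _ (h0 x hx))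
    (fun i hi hik => (h2 i hik x hx).trans (le_self_pow₀ hge (by omega)))
  refine key.trans (le_of_eq ?_)
  rw [mul_pow, inv_pow, ← pow_mul, pow_add, mul_inv]
  ring

theorem IsCBoundedNet.comp {f : Eps → Y → Z} {u : Eps → X → Y} (hf : IsCBoundedNet f)
    (hu : IsCBoundedNet u) : IsCBoundedNet (fun ε x => f ε (u ε x)) := by
  intro K hK
  obtain ⟨A, hA, hA'⟩ := hu K hK
  obtain ⟨B, hB, hB'⟩ := hf A hA
  refine ⟨B, hB, ?_⟩
  filter_upwards [hA', hB'] with ε h1 h2 x hx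
  exact h2 _ (h1 x hx)

theorem IsNegligible.comp [FiniteDimensional ℝ Y] {f g : Eps → Y → Z} {u v : Eps → X → Y}
    (hf : IsModerate f) (hfg : IsNegligible (fun ε x => f ε x - g ε x))
    (hu : IsCBoundedNet u) (hv : IsCBoundedNet v)
    (huv : IsNegligible (fun ε x => u ε x - v ε x)) :
    IsNegligible (fun ε x => f ε (u ε x) - g ε (v ε x)) := by
  have h2 : IsNegligible (fun ε x => f ε (v ε x) - g ε (v ε x)) := by
    intro K hK m
    obtain ⟨A, hA, hA'⟩ := hv K hK
    obtain ⟨C, hC⟩ := hfg A hA m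
    refine ⟨C, ?_⟩
    filter_upwards [hA', hC] with ε h1 h2 x hx
    exact h2 _ (h1 x hx)
  refine IsNegligible.trans (v := fun ε x => f ε (v ε x)) ?_ h2
  intro K hK m
  have : ProperSpace Y := FiniteDimensional.proper_real Y
  obtain ⟨A, hA, hA'⟩ := hu K hK
  obtain ⟨B, hB, hB'⟩ := hv K hK
  obtain ⟨R, hR⟩ := (hA.union hB).isBounded.subset_closedBall 0
  obtain ⟨N, C, hC⟩ := hf.fderiv.moderate _ (isCompact_closedBall (0 : Y) R) 0
  obtain ⟨D, hD⟩ := huv K hK (m + N)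
  refine ⟨C * D, ?_⟩
  filter_upwards [hA', hB', hC, hD] with ε a1 a2 a3 a4 x hx
  have e0 : (0 : ℝ) < ε := ε.2.1
  have hux := hR (Or.inl (a1 x hx))
  have hvx := hR (Or.inr (a2 x hx))
  have hb : ∀ y ∈ Metric.closedBall (0 : Y) R, ‖_root_.fderiv ℝ (f ε) y‖
      ≤ C * ((ε : ℝ) ^ N)⁻¹ := fun y hy => by simpa using a3 y hy
  have hC0 : 0 ≤ C * ((ε : ℝ) ^ N)⁻¹ := (norm_nonneg _).trans (hb _ hux)
  have key := Convex.norm_image_sub_le_of_norm_fderiv_le (𝕜 := ℝ) (f := f ε)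
    (fun y _ => (hf.smooth ε).differentiable (by simp) y) hb
    (convex_closedBall (0 : Y) R) hvx hux
  calc _ ≤ C * ((ε : ℝ) ^ N)⁻¹ * ‖u ε x - v ε x‖ := key
    _ ≤ C * ((ε : ℝ) ^ N)⁻¹ * (D * (ε : ℝ) ^ (m + N)) := by gcongr; exact a4 x hx
    _ = C * D * (ε : ℝ) ^ m := by
        rw [pow_add]
        field_simp

/-- For moderate nets, negligibility of the values implies that of the first derivatives. -/
theorem IsNegligible.fderiv [FiniteDimensional ℝ X] {u : Eps → X → Y} (hu : IsModerate u)
    (h0 : IsNegligible u) : IsNegligible (fun ε => _root_.fderiv ℝ (u ε)) := by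
  intro K hK m
  have : ProperSpace X := FiniteDimensional.proper_real X
  obtain ⟨N, C, hC⟩ := hu.fderiv.fderiv.moderate _ (hK.cthickening (r := 1)) 0
  obtain ⟨D, hD⟩ := h0 _ (hK.cthickening (r := 1)) (m + N + m)
  refine ⟨2 * D + C, ?_⟩
  filter_upwards [hC, hD] with ε h1 h2 x hx
  have e0 : (0 : ℝ) < ε := ε.2.1
  have e1 : (ε : ℝ) ≤ 1 := ε.2.2
  have hh0 : 0 < (ε : ℝ) ^ (m + N) := by positivity
  have hh1 : (ε : ℝ) ^ (m + N) ≤ 1 := pow_le_one₀ e0.le e1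
  set s := Metric.closedBall x ((ε : ℝ) ^ (m + N)) with hs
  have hsub : s ⊆ Metric.cthickening 1 K :=
    (Metric.closedBall_subset_closedBall hh1).trans (Metric.closedBall_subset_cthickening hx 1)
  have hxs : x ∈ s := Metric.mem_closedBall_self hh0.le
  have b2 : ∀ y ∈ s, ‖_root_.fderiv ℝ (_root_.fderiv ℝ (u ε)) y‖ ≤ C * ((ε : ℝ) ^ N)⁻¹ :=
    fun y hy => by simpa using h1 y (hsub hy)
  have hC0 : 0 ≤ C * ((ε : ℝ) ^ N)⁻¹ := 
    le_trans (norm_nonneg (_root_.fderiv ℝ (_root_.fderiv ℝ (u ε)) x)) (b2 x hxs)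
  have hD0 : 0 ≤ D * (ε : ℝ) ^ (m + N + m) := (norm_nonneg _).trans (h2 x (hsub hxs))
  have b1 : ∀ y ∈ s, ‖_root_.fderiv ℝ (u ε) y - _root_.fderiv ℝ (u ε) x‖ ≤ C * (ε : ℝ) ^ m := by
    intro y hy
    have k := Convex.norm_image_sub_le_of_norm_fderiv_le (𝕜 := ℝ) (f := _root_.fderiv ℝ (u ε))
      (fun z _ => (hu.fderiv.smooth ε).differentiable (by simp) z) b2
      (convex_closedBall x _) hxs hy
    have hy' : ‖y - x‖ ≤ (ε : ℝ) ^ (m + N) := by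
      rw [← dist_eq_norm]
      exact hy
    calc _ ≤ C * ((ε : ℝ) ^ N)⁻¹ * ‖y - x‖ := k
      _ ≤ C * ((ε : ℝ) ^ N)⁻¹ * (ε : ℝ) ^ (m + N) := by gcongr
      _ = _ := by
        rw [pow_add]
        field_simp
  have hC1 : 0 ≤ C * (ε : ℝ) ^ m := (norm_nonneg _).trans (b1 x hxs)
  have hD1 : 0 ≤ D * (ε : ℝ) ^ m := by
    rw [pow_add] at hD0
    have : 0 ≤ D := by
      by_contra hneg
      have : D * ((ε : ℝ) ^ (m + N) * (ε : ℝ) ^ m) < 0 :=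
        mul_neg_of_neg_of_pos (not_le.1 hneg) (by positivity)
      linarith
    positivity
  refine ContinuousLinearMap.opNorm_le_of_unit_norm (by nlinarith) fun w hw => ?_
  set y := x + (ε : ℝ) ^ (m + N) • w with hy
  have hyx : y - x = (ε : ℝ) ^ (m + N) • w := by simp [hy]
  have hnyx : ‖y - x‖ = (ε : ℝ) ^ (m + N) := by
    rw [hyx, norm_smul, hw, mul_one, Real.norm_of_nonneg hh0.le]
  have hys : y ∈ s := by
    rw [hs, Metric.mem_closedBall, dist_eq_norm, hnyx]
  have k := Convex.norm_image_sub_le_of_norm_fderiv_le' (𝕜 := ℝ) (f := u ε)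
    (φ := _root_.fderiv ℝ (u ε) x)
    (fun z _ => (hu.smooth ε).differentiable (by simp) z) b1 (convex_closedBall x _) hxs hys
  rw [hnyx, hyx, map_smul] at k
  have k2 : ‖(ε : ℝ) ^ (m + N) • _root_.fderiv ℝ (u ε) x w‖
      ≤ ‖u ε y‖ + ‖u ε x‖ + C * (ε : ℝ) ^ m * (ε : ℝ) ^ (m + N) := by
    have e : (ε : ℝ) ^ (m + N) • _root_.fderiv ℝ (u ε) x w
        = (u ε y - u ε x) - (u ε y - u ε x - (ε : ℝ) ^ (m + N) • _root_.fderiv ℝ (u ε) x w) := by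
      abel
    rw [e]
    exact (norm_sub_le _ _).trans (add_le_add (norm_sub_le _ _) k)
  rw [norm_smul, Real.norm_of_nonneg hh0.le] at k2
  have k3 := h2 y (hsub hys)
  have k4 := h2 x (hsub hxs)
  have k5 : (ε : ℝ) ^ (m + N) * ‖_root_.fderiv ℝ (u ε) x w‖
      ≤ (ε : ℝ) ^ (m + N) * ((2 * D + C) * (ε : ℝ) ^ m) := by
    rw [pow_add _ (m + N) m] at k3 k4
    nlinarith
  exact le_of_mul_le_mul_left k5 hh0

theorem IsModerate.iteratedFDeriv {u : Eps → X → Y} (hu : IsModerate u) (k : ℕ) :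
    IsModerate (fun ε => _root_.iteratedFDeriv ℝ k (u ε)) := by
  induction k with
  | zero =>
    exact hu.clm
      (continuousMultilinearCurryFin0 ℝ X Y).symm.toContinuousLinearEquiv.toContinuousLinearMap
  | succ k ih =>
    exact ih.fderiv.clm (continuousMultilinearCurryLeftEquiv ℝ
      (fun _ : Fin (k + 1) => X) Y).symm.toContinuousLinearEquiv.toContinuousLinearMap

/-- For moderate nets, negligibility of the values implies that of all derivatives. -/
theorem IsNegligible.allOrders [FiniteDimensional ℝ X] {u : Eps → X → Y} (hu : IsModerate u)
    (h0 : IsNegligible u) : IsNegligibleAllOrders u := by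
  intro k
  change IsNegligible (fun ε => _root_.iteratedFDeriv ℝ k (u ε))
  induction k with
  | zero =>
    intro K hK m
    simpa using h0 K hK m
  | succ k ih =>
    intro K hK m
    obtain ⟨C, hC⟩ := ih.fderiv (hu.iteratedFDeriv k) K hK m
    refine ⟨C, ?_⟩
    filter_upwards [hC] with ε h x hx
    rw [← norm_fderiv_iteratedFDeriv]
    exact h x hx

theorem IsNegligibleAllOrders.negligible {u : Eps → X → Y} (h : IsNegligibleAllOrders u) :
    IsNegligible u := by
  intro K hK m
  simpa using h 0 K hK m

end Nets

/-! ### The spaces of generalized functions -/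

section Spaces

variable (X Y : Type*) [NormedAddCommGroup X] [NormedSpace ℝ X]
  [NormedAddCommGroup Y] [NormedSpace ℝ Y]

/-- Moderate nets modulo negligible nets. -/
def genSetoid : Setoid {u : Eps → X → Y // IsModerate u} where
  r u v := IsNegligible (fun ε x => u.1 ε x - v.1 ε x)
  iseqv := ⟨fun u => IsNegligible.refl u.1, fun h => h.symm, fun h1 h2 => h1.trans h2⟩

/-- Colombeau generalized functions on `X` with values in the vector space `Y`; for `X = ℝⁿ` and
`Y = ℝᵐ` this is the product `𝒢(ℝⁿ)ᵐ` of `m` copies of the special Colombeau algebra. -/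
def Gen : Type _ := Quotient (genSetoid X Y)

/-- Two moderate c-bounded nets are equivalent iff on compact sets the derivatives
of all orders of their difference are `O(ε ^ m)` for all `m`. -/
def cbddSetoid [FiniteDimensional ℝ X] :
    Setoid {u : Eps → X → Y // IsModerate u ∧ IsCBoundedNet u} where
  r u v := IsNegligibleAllOrders (fun ε x => u.1 ε x - v.1 ε x)
  iseqv :=
    ⟨fun u => (IsNegligible.refl u.1).allOrders (u.2.1.sub u.2.1),
      fun {u v} h => h.negligible.symm.allOrders (v.2.1.sub u.2.1),
      fun {u _ w} h1 h2 => (h1.negligible.trans h2.negligible).allOrders (u.2.1.sub w.2.1)⟩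

/-- The space `𝒢[X, Y]` of c-bounded generalized functions from `X` to `Y`. The vector spaces `X`
and `Y` are manifolds with the identity as global chart, in which the estimates are stated. -/
def CBdd [FiniteDimensional ℝ X] : Type _ := Quotient (cbddSetoid X Y)

end Spaces

section Operations

variable {X Y Z : Type*}
  [NormedAddCommGroup X] [NormedSpace ℝ X] [FiniteDimensional ℝ X]
  [NormedAddCommGroup Y] [NormedSpace ℝ Y]
  [NormedAddCommGroup Z] [NormedSpace ℝ Z]

/-- The net `u` is a representative of the generalized function `U`. -/
def Gen.IsRep {X Y : Type*} [NormedAddCommGroup X] [NormedSpace ℝ X] [NormedAddCommGroup Y]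
    [NormedSpace ℝ Y] (U : Gen X Y) (u : Eps → X → Y) : Prop :=
  ∃ hu : IsModerate u, Quotient.mk (genSetoid X Y) ⟨u, hu⟩ = U

/-- The canonical map `𝒢[X, Y] → 𝒢(X)ᵐ`, `[(u_ε)] ↦ [(u_ε)]` (injective, see below). -/
def CBdd.toGen : CBdd X Y → Gen X Y :=
  Quotient.map' (fun u => ⟨u.1, u.2.1⟩) fun _ _ h => IsNegligibleAllOrders.negligible h

theorem CBdd.toGen_injective : Function.Injective (CBdd.toGen : CBdd X Y → Gen X Y) := by
  intro U V
  induction U using Quotient.inductionOn with | _ u => ?_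
  induction V using Quotient.inductionOn with | _ v => ?_
  intro h
  exact Quotient.sound' (IsNegligible.allOrders (u.2.1.sub v.2.1) (Quotient.exact h))

/-- A generalized function is c-bounded if it belongs to `𝒢[X, Y]`, that is, if it has a c-bounded
representative. -/
def Gen.IsCBounded (U : Gen X Y) : Prop := ∃ V : CBdd X Y, V.toGen = U

/-- A smooth map regarded as a generalized function, via the constant net. -/
def CBdd.ofSmooth (f : X → Y) (hf : ContDiff ℝ ∞ f) : CBdd X Y :=
  Quotient.mk _ ⟨fun _ => f, isModerate_const hf, isCBoundedNet_const hf⟩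

/-- The composition `[(f_ε)] ∘ [(u_ε)] = [(f_ε ∘ u_ε)]` of a generalized function with a
c-bounded generalized function. -/
noncomputable def Gen.comp [FiniteDimensional ℝ Y] : Gen Y Z → CBdd X Y → Gen X Z :=
  Quotient.map₂ (fun f u => ⟨fun ε x => f.1 ε (u.1 ε x), f.2.comp u.2.1 u.2.2⟩)
    fun f g hf u v hu => IsNegligible.comp (f := f.1) (g := g.1) (u := u.1) (v := v.1)
      f.2 hf u.2.2 v.2.2 (IsNegligibleAllOrders.negligible hu)

/-- The composition `[(f_ε)] ∘ [(u_ε)] = [(f_ε ∘ u_ε)]` of c-bounded generalized functions. -/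
noncomputable def CBdd.comp [FiniteDimensional ℝ Y] : CBdd Y Z → CBdd X Y → CBdd X Z :=
  Quotient.map₂
    (fun f u => ⟨fun ε x => f.1 ε (u.1 ε x), f.2.1.comp u.2.1 u.2.2, f.2.2.comp u.2.2⟩)
    fun f g hf u v hu => IsNegligible.allOrders
      ((f.2.1.comp u.2.1 u.2.2).sub (g.2.1.comp v.2.1 v.2.2))
      (IsNegligible.comp (f := f.1) (g := g.1) (u := u.1) (v := v.1) f.2.1
        (IsNegligibleAllOrders.negligible hf) u.2.2 v.2.2 (IsNegligibleAllOrders.negligible hu))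

/-- The pair `(u, v)` of two c-bounded generalized functions on the same space. -/
noncomputable def CBdd.pair : CBdd X Y → CBdd X Z → CBdd X (Y × Z) :=
  Quotient.map₂
    (fun u v => ⟨fun ε x => (u.1 ε x, v.1 ε x), u.2.1.prodMk v.2.1, u.2.2.prodMk v.2.2⟩)
    fun u u' hu v v' hv => IsNegligible.allOrders
      ((u.2.1.prodMk v.2.1).sub (u'.2.1.prodMk v'.2.1))
      (IsNegligible.prodMk (IsNegligibleAllOrders.negligible hu)
        (IsNegligibleAllOrders.negligible hv))

end Operations

/-! ### Flows -/

section Flow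

variable {E : Type*} [NormedAddCommGroup E] [NormedSpace ℝ E]

theorem deriv_fst_eq {f : ℝ × E → E} (hf : ContDiff ℝ ∞ f) (p : ℝ × E) :
    deriv (fun t => f (t, p.2)) p.1 = fderiv ℝ f p (1, 0) := by
  have h1 : HasFDerivAt f (fderiv ℝ f p) (p.1, p.2) :=
    (hf.differentiable (by simp) p).hasFDerivAt
  have h2 : HasDerivAt (fun t : ℝ => (t, p.2)) ((1 : ℝ), (0 : E)) p.1 :=
    (hasDerivAt_id p.1).prodMk (hasDerivAt_const p.1 p.2)
  exact (h1.comp_hasDerivAt p.1 h2).deriv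

theorem fderiv_snd_eq {f : ℝ × E → E} (hf : ContDiff ℝ ∞ f) (p : ℝ × E) :
    fderiv ℝ (fun y => f (p.1, y)) p.2
      = (fderiv ℝ f p).comp (ContinuousLinearMap.inr ℝ ℝ E) := by
  have h1 : HasFDerivAt f (fderiv ℝ f p) (p.1, p.2) :=
    (hf.differentiable (by simp) p).hasFDerivAt
  exact (h1.comp p.2 (hasFDerivAt_prodMk_right p.1 p.2)).fderiv

theorem IsModerate.timeDeriv {u : Eps → ℝ × E → E} (hu : IsModerate u) :
    IsModerate (fun ε (p : ℝ × E) => deriv (fun t => u ε (t, p.2)) p.1) := by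
  have h := hu.fderiv.clm (ContinuousLinearMap.apply ℝ E ((1 : ℝ), (0 : E)))
  convert h using 3 with ε p
  exact deriv_fst_eq (hu.smooth ε) p

theorem IsModerate.spaceDeriv {u : Eps → ℝ × E → E} (hu : IsModerate u) :
    IsModerate (fun ε (p : ℝ × E) => _root_.fderiv ℝ (fun y => u ε (p.1, y)) p.2) := by
  have h := hu.fderiv.clm
    ((ContinuousLinearMap.compL ℝ E (ℝ × E) E).flip (ContinuousLinearMap.inr ℝ ℝ E))
  convert h using 3 with ε p
  exact fderiv_snd_eq (hu.smooth ε) p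

variable [FiniteDimensional ℝ E]

theorem IsNegligible.timeDeriv {u v : Eps → ℝ × E → E} (hu : IsModerate u) (hv : IsModerate v)
    (h : IsNegligible (fun ε x => u ε x - v ε x)) :
    IsNegligible (fun ε (p : ℝ × E) =>
      deriv (fun t => u ε (t, p.2)) p.1 - deriv (fun t => v ε (t, p.2)) p.1) := by
  have h1 := (IsNegligible.fderiv (hu.sub hv) h)
  have h2 : IsNegligible (fun ε x => _root_.fderiv ℝ (u ε) x - _root_.fderiv ℝ (v ε) x) := by
    convert h1 using 3 with ε x
    exact (fderiv_fun_sub ((hu.smooth ε).differentiable (by simp) x)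
      ((hv.smooth ε).differentiable (by simp) x)).symm
  have h3 := h2.clm (ContinuousLinearMap.apply ℝ E ((1 : ℝ), (0 : E)))
  convert h3 using 3 with ε p
  rw [deriv_fst_eq (hu.smooth ε), deriv_fst_eq (hv.smooth ε)]
  rfl

theorem IsNegligible.spaceDeriv {u v : Eps → ℝ × E → E} (hu : IsModerate u) (hv : IsModerate v)
    (h : IsNegligible (fun ε x => u ε x - v ε x)) :
    IsNegligible (fun ε (p : ℝ × E) => _root_.fderiv ℝ (fun y => u ε (p.1, y)) p.2
      - _root_.fderiv ℝ (fun y => v ε (p.1, y)) p.2) := by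
  have h1 := (IsNegligible.fderiv (hu.sub hv) h)
  have h2 : IsNegligible (fun ε x => _root_.fderiv ℝ (u ε) x - _root_.fderiv ℝ (v ε) x) := by
    convert h1 using 3 with ε x
    exact (fderiv_fun_sub ((hu.smooth ε).differentiable (by simp) x)
      ((hv.smooth ε).differentiable (by simp) x)).symm
  have h3 := h2.clm
    ((ContinuousLinearMap.compL ℝ E (ℝ × E) E).flip (ContinuousLinearMap.inr ℝ ℝ E))
  convert h3 using 3 with ε p
  rw [fderiv_snd_eq (hu.smooth ε), fderiv_snd_eq (hv.smooth ε)]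
  rfl

/-- The partial derivative `dΦ/dt = [(∂_t Φ_ε)]` of `Φ ∈ 𝒢[ℝ × E, E]`. -/
noncomputable def CBdd.timeDeriv : CBdd (ℝ × E) E → Gen (ℝ × E) E :=
  Quotient.map' (fun u => ⟨fun ε p => deriv (fun t => u.1 ε (t, p.2)) p.1, u.2.1.timeDeriv⟩)
    fun u v h => IsNegligible.timeDeriv u.2.1 v.2.1 (IsNegligibleAllOrders.negligible h)

/-- The spatial derivative `∇ₓΦ = [(∇ₓ Φ_ε)]` of `Φ ∈ 𝒢[ℝ × E, E]`. -/
noncomputable def CBdd.spaceDeriv : CBdd (ℝ × E) E → Gen (ℝ × E) (E →L[ℝ] E) :=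
  Quotient.map' (fun u => ⟨fun ε p => fderiv ℝ (fun y => u.1 ε (p.1, y)) p.2, u.2.1.spaceDeriv⟩)
    fun u v h => IsNegligible.spaceDeriv u.2.1 v.2.1 (IsNegligibleAllOrders.negligible h)

/-- `Φ` is a generalized flow of the system `x' = F(x)`. The three equations are equalities of
generalized functions on `ℝ × E`, `E` and `ℝ × ℝ × E`, whose points are written `(t, x)`, `x`
and `(t, s, x)`. -/
structure IsFlow (F : Gen E E) (Φ : CBdd (ℝ × E) E) : Prop where
  ode : Φ.timeDeriv = F.comp Φ
  initial : Φ.comp (CBdd.ofSmooth (fun x : E => ((0 : ℝ), x)) (by fun_prop))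
    = CBdd.ofSmooth (fun x : E => x) contDiff_id
  group : Φ.comp (CBdd.ofSmooth (fun p : ℝ × ℝ × E => (p.1 + p.2.1, p.2.2)) (by fun_prop))
    = Φ.comp (CBdd.pair (CBdd.ofSmooth (fun p : ℝ × ℝ × E => p.1) (by fun_prop))
        (Φ.comp (CBdd.ofSmooth (fun p : ℝ × ℝ × E => p.2) (by fun_prop))))

/-- `F` has a representative of linear growth, uniformly in small `ε`, whose gradient is locally
of `L^∞`-log-type. -/
def HasLinearGrowthAndLogTypeGradient (F : Gen E E) : Prop :=
  ∃ f : Eps → E → E, F.IsRep f ∧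
    (∃ C > (0 : ℝ), ∃ ε₀ > (0 : ℝ), ∀ ε : Eps, (ε : ℝ) < ε₀ → ∀ x, ‖f ε x‖ ≤ C * (1 + ‖x‖)) ∧
    ∀ K : Set E, IsCompact K → ∃ C : ℝ, ∀ᶠ ε in smallEps, ∀ x ∈ K,
      ‖fderiv ℝ (f ε) x‖ ≤ C * |Real.log (ε : ℝ)|

/-- `F` has a representative that, for small `ε`, is uniformly bounded at the origin and has
globally and uniformly bounded gradient. -/
def HasBoundedGradient (F : Gen E E) : Prop :=
  ∃ f : Eps → E → E, F.IsRep f ∧ ∃ C > (0 : ℝ), ∃ ε₀ > (0 : ℝ), ∀ ε : Eps, (ε : ℝ) < ε₀ →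
    ‖f ε 0‖ ≤ C ∧ ∀ x, ‖fderiv ℝ (f ε) x‖ ≤ C

end Flow

end Colombeau

namespace Colombeau

/-! ### Ordinary differential equations -/

section ODE

open Set Metric

variable {E : Type*} [NormedAddCommGroup E] [NormedSpace ℝ E]

/-! The proof works with representatives and combines classical flows with Grönwall estimates whose
dependence on `ε` is explicit. Changing a representative at non-small `ε` does not change its class,
so the bounds may be assumed for every `ε` (`Gen.IsRep.exists_truncation`). Linear growth then makes
each classical flow `φ ε` global and bounds it on compact sets independently of `ε`
(`exists_globalFlow`), hence the net of flows is c-bounded.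

The gradient enters only through a Grönwall factor `exp (c T |log ε|)`, which is a negative power of
`ε`; this is why a gradient of size `|log ε|` is affordable. The spatial derivatives of the flow
solve linear equations whose coefficient is composition with the gradient along the flow, and whose
inhomogeneity contains only lower derivatives of the solution. Induction on the order gives
moderateness (`isModerateTo_of_linear_ode`, `IsGlobalFlow.isModerate`). The flow identities hold
exactly for each `ε`.

For uniqueness, a representative of another flow satisfies the equation and the initial condition up
to negligible errors. Grönwall's inequality costs a fixed power of `ε`, which negligibility absorbs
(`IsFlow.eq_mk`). The time derivative is c-bounded because it equals the composition of `F` with the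
flow. With a uniform gradient bound `C` the Grönwall factor for the spatial derivative is `exp (C
T)`, independent of `ε`. -/

theorem gronwallBound_le {δ K e x : ℝ} (hK : 0 ≤ K) (he : 0 ≤ e) :
    gronwallBound δ K e x ≤ (δ + e * x) * Real.exp (K * x) := by
  rcases hK.eq_or_lt with rfl | hK
  · simp [gronwallBound_K0]
  · rw [gronwallBound_of_K_ne_0 hK.ne']
    -- This is `1 - exp (-y) ≤ y` multiplied by `exp y`, with `y = K * x`; it removes the division
    -- by `K`.
    have h1 : Real.exp (K * x) - 1 ≤ K * x * Real.exp (K * x) := by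
      have h2 := Real.add_one_le_exp (-(K * x))
      have h3 : Real.exp (-(K * x)) * Real.exp (K * x) = 1 := by
        rw [← Real.exp_add]
        simp
      nlinarith [Real.exp_pos (K * x)]
    have h2 : e / K * (Real.exp (K * x) - 1) ≤ e / K * (K * x * Real.exp (K * x)) := by gcongr
    have h3 : e / K * (K * x * Real.exp (K * x)) = e * x * Real.exp (K * x) := by
      field_simp
    linarith

theorem norm_le_exp_of_norm_deriv_le_of_nonneg {w w' : ℝ → E} {K δ T : ℝ} (hK : 0 ≤ K)
    (hδ : 0 ≤ δ) (hw : ∀ t ∈ Icc 0 T, HasDerivAt w (w' t) t)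
    (hb : ∀ t ∈ Icc 0 T, ‖w' t‖ ≤ K * ‖w t‖ + δ) {t : ℝ} (ht : t ∈ Icc 0 T) :
    ‖w t‖ ≤ (‖w 0‖ + δ * T) * Real.exp (K * T) := by
  have h := norm_le_gronwallBound_of_norm_deriv_right_le (f := w) (f' := w') (δ := ‖w 0‖) (K := K)
    (ε := δ) (a := 0) (b := T) (fun s hs => (hw s hs).continuousAt.continuousWithinAt)
    (fun s hs => (hw s ⟨hs.1, hs.2.le⟩).hasDerivWithinAt) le_rfl
    (fun s hs => hb s ⟨hs.1, hs.2.le⟩) t ht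
  rw [sub_zero] at h
  refine (h.trans (gronwallBound_le hK hδ)).trans ?_
  have := ht.1
  have := ht.2
  have hT : 0 ≤ T := by linarith
  have : 0 ≤ ‖w 0‖ + δ * T := by positivity
  gcongr

/-- A two-sided Grönwall inequality on `[-T, T]`. -/
theorem norm_le_exp_of_norm_deriv_le {w w' : ℝ → E} {K δ T : ℝ} (hK : 0 ≤ K)
    (hδ : 0 ≤ δ) (hw : ∀ t ∈ Icc (-T) T, HasDerivAt w (w' t) t)
    (hb : ∀ t ∈ Icc (-T) T, ‖w' t‖ ≤ K * ‖w t‖ + δ) {t : ℝ} (ht : t ∈ Icc (-T) T) :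
    ‖w t‖ ≤ (‖w 0‖ + δ * T) * Real.exp (K * T) := by
  have hT : 0 ≤ T := by linarith [ht.1, ht.2]
  rcases le_total 0 t with h | h
  · exact norm_le_exp_of_norm_deriv_le_of_nonneg hK hδ
      (fun s hs => hw s ⟨by linarith [hs.1], hs.2⟩)
      (fun s hs => hb s ⟨by linarith [hs.1], hs.2⟩) ⟨h, ht.2⟩
  · have h1 := norm_le_exp_of_norm_deriv_le_of_nonneg (w := fun s => w (-s))
      (w' := fun s => -w' (-s)) (t := -t) (T := T) hK hδ
      (fun s hs => by
        have := (hw (-s) ⟨by linarith [hs.2], by linarith [hs.1]⟩).scomp s (hasDerivAt_neg s)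
        simpa [Function.comp_def] using this)
      (fun s hs => by
        rw [norm_neg]
        exact hb (-s) ⟨by linarith [hs.2], by linarith [hs.1]⟩)
      ⟨by linarith, by linarith [ht.1]⟩
    simpa using h1

/-- Time-dependent vector fields that are continuous in time, locally Lipschitz and of linear growth
in space, both uniformly on bounded time intervals. -/
structure IsLinearGrowthField (v : ℝ → E → E) : Prop where
  continuous_time : ∀ x, Continuous (v · x)
  lipschitz : ∀ T R : ℝ, ∃ K : NNReal, ∀ t ∈ Icc (-T) T, LipschitzOnWith K (v t) (closedBall 0 R)
  growth : ∀ T : ℝ, ∃ C : ℝ, 0 ≤ C ∧ ∀ t ∈ Icc (-T) T, ∀ x, ‖v t x‖ ≤ C * (1 + ‖x‖)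

/-- A priori bound depending only on `C`, `T` and the initial value. It confines solutions to a
known ball and is later uniform in `ε`. -/
theorem norm_le_of_linear_growth {α α' : ℝ → E} {C T : ℝ} (hC : 0 ≤ C)
    (hα : ∀ t ∈ Icc (-T) T, HasDerivAt α (α' t) t)
    (hb : ∀ t ∈ Icc (-T) T, ‖α' t‖ ≤ C * (1 + ‖α t‖)) {t : ℝ} (ht : t ∈ Icc (-T) T) :
    ‖α t‖ ≤ (‖α 0‖ + C * T) * Real.exp (C * T) :=
  norm_le_exp_of_norm_deriv_le hC hC hα
    (fun s hs => (hb s hs).trans (le_of_eq (by ring))) ht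

/-- The a priori bound puts both solutions into one ball, on which the field is Lipschitz; Grönwall
applies to the difference. -/
theorem IsLinearGrowthField.eqOn {v : ℝ → E → E} (hv : IsLinearGrowthField v) {α β : ℝ → E} {T : ℝ}
    (hα : ∀ t ∈ Icc (-T) T, HasDerivAt α (v t (α t)) t)
    (hβ : ∀ t ∈ Icc (-T) T, HasDerivAt β (v t (β t)) t) (h0 : α 0 = β 0) :
    EqOn α β (Icc (-T) T) := by
  intro t ht
  obtain ⟨C, hC, hg⟩ := hv.growth T
  have hαb := fun s hs => norm_le_of_linear_growth (t := s) hC hα (fun t ht => hg t ht _) hs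
  have hβb := fun s hs => norm_le_of_linear_growth (t := s) hC hβ (fun t ht => hg t ht _) hs
  rw [← h0] at hβb
  obtain ⟨K, hK⟩ := hv.lipschitz T ((‖α 0‖ + C * T) * Real.exp (C * T))
  have h := norm_le_exp_of_norm_deriv_le (w := fun s => α s - β s) (K := K) (δ := 0) (T := T)
    K.2 le_rfl (fun s hs => (hα s hs).sub (hβ s hs))
    (fun s hs => by
      rw [add_zero]
      exact (hK s hs).norm_sub_le (by simpa using hαb s hs) (by simpa using hβb s hs)) ht
  simp only [h0, sub_self, norm_zero, zero_mul, add_zero, norm_le_zero_iff] at h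
  exact sub_eq_zero.1 h

/-- The Picard–Lindelöf theorem needs a ball large compared with the speed times the length of the
interval, but the speed may grow with the ball. Multiplying the field by a cutoff `χ` makes it
globally bounded and keeps the linear growth. The a priori bound then keeps the solution where `χ =
1`. -/
theorem IsLinearGrowthField.exists_Icc [CompleteSpace E] {v : ℝ → E → E}
    (hv : IsLinearGrowthField v) (x₀ : E) {T : ℝ} (hT : 0 ≤ T) :
    ∃ α : ℝ → E, α 0 = x₀ ∧ ∀ t ∈ Icc (-T) T, HasDerivAt α (v t (α t)) t := by
  -- The extra unit of time makes `-T` and `T` interior points, so that two-sided derivatives exist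
  -- there.
  obtain ⟨C, hC, hg⟩ := hv.growth (T + 1)
  obtain ⟨R, hR⟩ : ∃ R : ℝ, R = (‖x₀‖ + C * T) * Real.exp (C * T) := ⟨_, rfl⟩
  have hR0 : 0 ≤ R := by
    rw [hR]
    positivity
  set χ : E → ℝ := fun x => max 0 (min 1 (R + 1 - ‖x‖)) with hχ
  have hχ0 : ∀ x, 0 ≤ χ x := fun x => le_max_left _ _
  have hχ1 : ∀ x, χ x ≤ 1 := fun x => max_le zero_le_one (min_le_left _ _)
  have hχR : ∀ x, ‖x‖ ≤ R → χ x = 1 := fun x hx => by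
    simp only [hχ]
    rw [min_eq_left (by linarith), max_eq_right zero_le_one]
  have hχlip : ∀ x y, |χ x - χ y| ≤ ‖x - y‖ := fun x y => by
    have h1 : |χ x - χ y| ≤ |min 1 (R + 1 - ‖x‖) - min 1 (R + 1 - ‖y‖)| := by
      have := abs_max_sub_max_le_max (0 : ℝ) (min 1 (R + 1 - ‖x‖)) 0 (min 1 (R + 1 - ‖y‖))
      simpa using this
    have h2 : |min 1 (R + 1 - ‖x‖) - min 1 (R + 1 - ‖y‖)| ≤ |‖x‖ - ‖y‖| := by
      have := abs_min_sub_min_le_max (1 : ℝ) (R + 1 - ‖x‖) 1 (R + 1 - ‖y‖)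
      simp only [sub_self, abs_zero] at this
      rw [max_eq_right (abs_nonneg _)] at this
      refine this.trans (le_of_eq ?_)
      rw [abs_sub_comm ‖x‖]
      congr 1
      ring
    exact h1.trans (h2.trans (abs_norm_sub_norm_le x y))
  have hb : ∀ t ∈ Icc (-(T + 1)) (T + 1), ∀ x, ‖χ x • v t x‖ ≤ C * (1 + ‖x‖) := fun t ht x => by
    rw [norm_smul, Real.norm_of_nonneg (hχ0 x)]
    have := hg t ht x
    nlinarith [hχ1 x, hχ0 x, norm_nonneg (v t x)]
  have hL : ∀ t ∈ Icc (-(T + 1)) (T + 1), ∀ x, ‖χ x • v t x‖ ≤ C * (2 + R) := fun t ht x => by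
    by_cases hx : ‖x‖ ≤ R + 1
    · refine (hb t ht x).trans ?_
      exact mul_le_mul_of_nonneg_left (by linarith) hC
    · have : χ x = 0 := by
        simp only [hχ]
        rw [max_eq_left]
        exact (min_le_right _ _).trans (by linarith [not_le.1 hx])
      rw [this, zero_smul, norm_zero]
      positivity
  lift C to NNReal using hC
  lift R to NNReal using hR0
  lift T to NNReal using hT
  -- Maximal speed of the truncated field times the length of the time interval on either side of
  -- `0`.
  set a : NNReal := C * (2 + R) * (T + 1) with ha
  obtain ⟨K, hK⟩ := hv.lipschitz (T + 1) (‖x₀‖ + a)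
  have hsub : closedBall x₀ (a : ℝ) ⊆ closedBall 0 (‖x₀‖ + a) :=
    closedBall_subset_closedBall' (by simp [add_comm])
  have hPL : IsPicardLindelof (fun t x => χ x • v t x) (tmin := -((T : ℝ) + 1)) (tmax := T + 1)
      ⟨0, by linarith [T.coe_nonneg], by positivity⟩ x₀ a 0 (C * (2 + R))
      -- Product rule: `K` comes from `v` since `χ ≤ 1`; the other term is the bound of `v` on the
      -- ball, since `χ` is 1-Lipschitz.
      (K + C * (1 + (‖x₀‖₊ + a))) :=
    { lipschitzOnWith := fun t ht => by
        refine LipschitzOnWith.of_dist_le_mul fun x hx y hy => ?_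
        have hx' := hsub hx
        have hy' := hsub hy
        rw [dist_eq_norm, dist_eq_norm]
        have e : χ x • v t x - χ y • v t y = χ y • (v t x - v t y) + (χ x - χ y) • v t x := by
          module
        rw [e]
        refine (norm_add_le _ _).trans ?_
        rw [norm_smul, norm_smul, Real.norm_of_nonneg (hχ0 y), Real.norm_eq_abs]
        have h1 := (hK t ht).norm_sub_le hx' hy'
        have h2 : ‖v t x‖ ≤ C * (1 + (‖x₀‖ + a)) := by
          refine (hg t ht x).trans ?_
          gcongr
          simpa using hx'
        have h3 := hχlip x y
        push_cast
        calc χ y * ‖v t x - v t y‖ + |χ x - χ y| * ‖v t x‖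
            ≤ 1 * (K * ‖x - y‖) + ‖x - y‖ * (C * (1 + (‖x₀‖ + a))) := by
              gcongr
              exact hχ1 y
          _ = _ := by
              ring
      continuousOn := fun x _ => (continuous_const.smul (hv.continuous_time x)).continuousOn
      norm_le := fun t ht x _ => by
        simpa using hL t ht x
      mul_max_le := by
        simp [ha] }
  obtain ⟨α, hα0, hα⟩ := hPL.exists_eq_forall_mem_Icc_hasDerivWithinAt₀
  have hα' : ∀ t ∈ Icc (-(T : ℝ)) T, HasDerivAt α (χ (α t) • v t (α t)) t := fun t ht =>
    (hα t ⟨by linarith [ht.1], by linarith [ht.2]⟩).hasDerivAt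
      (Icc_mem_nhds (by linarith [ht.1]) (by linarith [ht.2]))
  refine ⟨α, hα0, fun t ht => ?_⟩
  have h := norm_le_of_linear_growth C.2 hα' 
    (fun s hs => hb s ⟨by linarith [hs.1], by linarith [hs.2]⟩ _) ht
  have h1 := hα' t ht
  rwa [hχR, one_smul] at h1
  rw [hR]
  simpa [hα0] using h

/-- Global existence for vector fields of linear growth. -/
theorem IsLinearGrowthField.exists_global [CompleteSpace E] {v : ℝ → E → E}
    (hv : IsLinearGrowthField v) (x₀ : E) :
    ∃ α : ℝ → E, α 0 = x₀ ∧ ∀ t, HasDerivAt α (v t (α t)) t := by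
  choose α h0 hα using fun n : ℕ => hv.exists_Icc x₀ (T := n) n.cast_nonneg
  have hle : ∀ {m n : ℕ} {t : ℝ}, m ≤ n → t ∈ Icc (-(m : ℝ)) m → α m t = α n t := by
    intro m n t hmn ht
    have hmn' : (m : ℝ) ≤ n := by exact_mod_cast hmn
    exact hv.eqOn (hα m) (fun s hs => hα n s ⟨by linarith [hs.1], by linarith [hs.2]⟩)
      ((h0 m).trans (h0 n).symm) ht
  have hmem : ∀ t : ℝ, t ∈ Icc (-(⌈|t|⌉₊ : ℝ)) ⌈|t|⌉₊ := fun t => abs_le.1 (Nat.le_ceil _)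
  have heq : ∀ (n : ℕ) (t : ℝ), t ∈ Icc (-(n : ℝ)) n → α ⌈|t|⌉₊ t = α n t := fun n t ht =>
    hle (Nat.ceil_le.2 (abs_le.2 ht)) (hmem t)
  refine ⟨fun t => α ⌈|t|⌉₊ t, by simp [h0], fun t => ?_⟩
  -- With one unit added, `t` is interior to `[-n, n]`, so the glued function coincides with `α n`
  -- near `t`.
  set n := ⌈|t|⌉₊ + 1 with hn
  have ht : t ∈ Ioo (-(n : ℝ)) n := by
    have := hmem t
    rw [hn]
    push_cast
    exact ⟨by linarith [this.1], by linarith [this.2]⟩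
  have h1 := hα n t ⟨ht.1.le, ht.2.le⟩
  rw [← heq n t ⟨ht.1.le, ht.2.le⟩] at h1
  refine h1.congr_of_eventuallyEq ?_
  filter_upwards [Ioo_mem_nhds ht.1 ht.2] with s hs
  exact heq n s ⟨hs.1.le, hs.2.le⟩

/-- Linear equations with continuous coefficients have global solutions. -/
theorem exists_linear_ode [CompleteSpace E] {A : ℝ → E →L[ℝ] E} (hA : Continuous A) (x₀ : E) :
    ∃ α : ℝ → E, α 0 = x₀ ∧ ∀ t, HasDerivAt α (A t (α t)) t := by
  have hb : ∀ T : ℝ, ∃ C : ℝ, 0 ≤ C ∧ ∀ t ∈ Icc (-T) T, ‖A t‖ ≤ C := fun T => by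
    obtain ⟨C, h⟩ := (isCompact_Icc (a := -T) (b := T)).exists_bound_of_continuousOn hA.continuousOn
    exact ⟨max C 0, le_max_right _ _, fun t ht => (h t ht).trans (le_max_left _ _)⟩
  refine IsLinearGrowthField.exists_global (v := fun t x => A t x)
    ⟨fun x => hA.clm_apply continuous_const, fun T R => ?_, fun T => ?_⟩ x₀
  · obtain ⟨C, hC, h⟩ := hb T
    exact ⟨⟨C, hC⟩, fun t ht => ((A t).lipschitz.weaken (h t ht)).lipschitzOnWith⟩
  · obtain ⟨C, hC, h⟩ := hb T
    refine ⟨C, hC, fun t ht x => ?_⟩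
    calc ‖A t x‖ ≤ ‖A t‖ * ‖x‖ := (A t).le_opNorm x
      _ ≤ C * (1 + ‖x‖) := by
        gcongr
        · exact h t ht
        · linarith

end ODE

end Colombeau

namespace Colombeau

/-! ### Smoothness of global flows -/

section SmoothFlow

open Set Metric Asymptotics

universe u

variable {E : Type u} [NormedAddCommGroup E] [NormedSpace ℝ E]

/-- `φ` is a globally defined flow of the smooth vector field `f`, bounded on bounded sets. -/
structure IsGlobalFlow (f : E → E) (φ : ℝ × E → E) : Prop where
  smooth : ContDiff ℝ ∞ f
  init : ∀ x, φ (0, x) = x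
  hasDerivAt : ∀ t x, HasDerivAt (fun s => φ (s, x)) (f (φ (t, x))) t
  bounded : ∀ T R : ℝ, ∃ M : ℝ, ∀ t ∈ Icc (-T) T, ∀ x ∈ closedBall (0 : E) R, ‖φ (t, x)‖ ≤ M

/-- `L` is the solution of the linearization of `x' = f x` along the trajectories of `φ`. -/
structure IsLinearizedFlow (f : E → E) (φ : ℝ × E → E) (L : ℝ → E → E →L[ℝ] E) : Prop where
  init : ∀ x, L 0 x = ContinuousLinearMap.id ℝ E
  hasDerivAt : ∀ t x, HasDerivAt (fun s => L s x) ((fderiv ℝ f (φ (t, x))).comp (L t x)) t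

theorem exists_bound_closedBall [FiniteDimensional ℝ E] {G : Type*} [NormedAddCommGroup G]
    {g : E → G} (hg : Continuous g) (M : ℝ) :
    ∃ K : ℝ, 0 ≤ K ∧ ∀ x ∈ closedBall (0 : E) M, ‖g x‖ ≤ K := by
  have : ProperSpace E := FiniteDimensional.proper_real E
  obtain ⟨K, hK⟩ := (isCompact_closedBall (0 : E) M).exists_bound_of_continuousOn hg.continuousOn
  exact ⟨max K 0, le_max_right _ _, fun x hx => (hK x hx).trans (le_max_left _ _)⟩

/-- On the segment from `a` to `b` the derivative differs from its value at `a` by at most `K * ‖b -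
a‖`; the mean value inequality gives the second factor. -/
theorem norm_taylor_le {s : Set E} (hs : Convex ℝ s) {f : E → E} (hf : ContDiff ℝ ∞ f) {K : ℝ}
    (hK : ∀ x ∈ s, ‖fderiv ℝ (fderiv ℝ f) x‖ ≤ K) {a b : E} (ha : a ∈ s) (hb : b ∈ s) :
    ‖f b - f a - fderiv ℝ f a (b - a)‖ ≤ K * ‖b - a‖ ^ 2 := by
  have hK0 : 0 ≤ K := (norm_nonneg (fderiv ℝ (fderiv ℝ f) a)).trans (hK a ha)
  have hf' : ContDiff ℝ ∞ (fderiv ℝ f) := hf.fderiv_right (by norm_cast)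
  have h := Convex.norm_image_sub_le_of_norm_fderiv_le' (𝕜 := ℝ) (f := f) (s := segment ℝ a b)
    (φ := fderiv ℝ f a) (C := K * ‖b - a‖)
    (fun z _ => hf.differentiable (by simp) z) (fun z hz => by
      have h1 := hs.norm_image_sub_le_of_norm_fderiv_le (𝕜 := ℝ) (f := fderiv ℝ f)
        (fun z _ => hf'.differentiable (by simp) z) hK ha (hs.segment_subset ha hb hz)
      exact h1.trans (mul_le_mul_of_nonneg_left (norm_sub_le_of_mem_segment hz) hK0))
    (convex_segment a b) (left_mem_segment ℝ a b) (right_mem_segment ℝ a b)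
  refine h.trans (le_of_eq ?_)
  ring

variable [FiniteDimensional ℝ E] {f : E → E} {φ : ℝ × E → E} {L : ℝ → E → E →L[ℝ] E}

theorem IsGlobalFlow.continuous_time (h : IsGlobalFlow f φ) (x : E) :
    Continuous fun t => φ (t, x) :=
  continuous_iff_continuousAt.2 fun t => (h.hasDerivAt t x).continuousAt

theorem IsGlobalFlow.norm_sub_le (h : IsGlobalFlow f φ) {T M K : ℝ}
    (hK0 : 0 ≤ K) (hK : ∀ x ∈ closedBall (0 : E) M, ‖fderiv ℝ f x‖ ≤ K) {x y : E}
    (hx : ∀ t ∈ Icc (-T) T, ‖φ (t, x)‖ ≤ M) (hy : ∀ t ∈ Icc (-T) T, ‖φ (t, y)‖ ≤ M)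
    {t : ℝ} (ht : t ∈ Icc (-T) T) : ‖φ (t, y) - φ (t, x)‖ ≤ ‖y - x‖ * Real.exp (K * T) := by
  have := norm_le_exp_of_norm_deriv_le (w := fun t => φ (t, y) - φ (t, x)) (δ := 0) hK0 le_rfl
    (fun s _ => (h.hasDerivAt s y).sub (h.hasDerivAt s x))
    (fun s hs => by
      rw [add_zero]
      exact (convex_closedBall (0 : E) M).norm_image_sub_le_of_norm_fderiv_le (𝕜 := ℝ) (f := f)
        (fun z _ => h.smooth.differentiable (by simp) z) hK (by simpa using hx s hs)
        (by simpa using hy s hs)) ht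
  simpa [h.init] using this

/-- Both curves stay in one ball over `[-|t|, |t|]`, where the derivative of `f` is bounded. -/
theorem IsGlobalFlow.eq_of_hasDerivAt (h : IsGlobalFlow f φ) {α : ℝ → E}
    (hα : ∀ t, HasDerivAt α (f (α t)) t) (t : ℝ) : α t = φ (t, α 0) := by
  have hac : Continuous α := continuous_iff_continuousAt.2 fun t => (hα t).continuousAt
  obtain ⟨M₁, hM₁⟩ := (isCompact_Icc (a := -|t|) (b := |t|)).exists_bound_of_continuousOn
    hac.continuousOn
  obtain ⟨M₂, hM₂⟩ := (isCompact_Icc (a := -|t|) (b := |t|)).exists_bound_of_continuousOn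
    (h.continuous_time (α 0)).continuousOn
  obtain ⟨K, hK0, hK⟩ := exists_bound_closedBall
    (h.smooth.continuous_fderiv (by simp)) (max M₁ M₂)
  have := norm_le_exp_of_norm_deriv_le (w := fun t => α t - φ (t, α 0)) (δ := 0) hK0 le_rfl
    (fun s _ => (hα s).sub (h.hasDerivAt s _))
    (fun s hs => by
      rw [add_zero]
      exact (convex_closedBall (0 : E) _).norm_image_sub_le_of_norm_fderiv_le (𝕜 := ℝ) (f := f)
        (fun z _ => h.smooth.differentiable (by simp) z) hK
        (by simpa using Or.inr (hM₂ s hs)) (by simpa using Or.inl (hM₁ s hs)))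
    (abs_le.1 (le_refl |t|))
  simp only [h.init, sub_self, norm_zero, zero_mul, add_zero, norm_le_zero_iff] at this
  exact sub_eq_zero.1 this

/-- As a function of `t`, the left side is a solution that starts at `φ (s, x)`; uniqueness does the
rest. -/
theorem IsGlobalFlow.add (h : IsGlobalFlow f φ) (t s : ℝ) (x : E) :
    φ (t + s, x) = φ (t, φ (s, x)) := by
  have := h.eq_of_hasDerivAt (α := fun t => φ (t + s, x))
    (fun t => (h.hasDerivAt (t + s) x).comp_add_const t s) t
  simpa using this

/-- For fixed `x` this is a linear equation in the space of operators, with left composition as its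
coefficient. -/
theorem IsGlobalFlow.exists_linearizedFlow (h : IsGlobalFlow f φ) :
    ∃ L, IsLinearizedFlow f φ L := by
  have : CompleteSpace E := FiniteDimensional.complete ℝ E
  have hA : ∀ x, Continuous fun t =>
      ContinuousLinearMap.compL ℝ E E E (fderiv ℝ f (φ (t, x))) := fun x =>
    (ContinuousLinearMap.continuous _).comp
      ((h.smooth.continuous_fderiv (by simp)).comp (h.continuous_time x))
  choose L h0 hL using fun x => exists_linear_ode (hA x) (ContinuousLinearMap.id ℝ E)
  exact ⟨fun t x => L x t, h0, fun t x => hL x t⟩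

theorem IsLinearizedFlow.norm_le (hL : IsLinearizedFlow f φ L) {T M K : ℝ}
    (hK0 : 0 ≤ K) (hK : ∀ x ∈ closedBall (0 : E) M, ‖fderiv ℝ f x‖ ≤ K) {x : E}
    (hx : ∀ t ∈ Icc (-T) T, ‖φ (t, x)‖ ≤ M) {t : ℝ} (ht : t ∈ Icc (-T) T) :
    ‖L t x‖ ≤ Real.exp (K * T) := by
  have := norm_le_exp_of_norm_deriv_le (w := fun t => L t x) (δ := 0) hK0 le_rfl
    (fun s _ => hL.hasDerivAt s x)
    (fun s hs => by
      rw [add_zero]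
      refine (ContinuousLinearMap.opNorm_comp_le _ _).trans ?_
      gcongr
      exact hK _ (by simpa using hx s hs)) ht
  rw [zero_mul, add_zero, hL.init] at this
  refine this.trans ?_
  have h1 := ContinuousLinearMap.norm_id_le (𝕜 := ℝ) (E := E)
  have h2 := Real.exp_pos (K * T)
  nlinarith

/-- The difference vanishes at time `0` and solves the linearized equation up to a Taylor remainder.
That remainder is quadratic in the distance of the trajectories, which is at most `‖y - x‖ * exp (K₁
* T)`. -/
theorem IsGlobalFlow.exists_quadratic_bound (h : IsGlobalFlow f φ)
    (hL : IsLinearizedFlow f φ L) (T R : ℝ) :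
    ∃ C : ℝ, ∀ t ∈ Icc (-T) T, ∀ x ∈ closedBall (0 : E) R, ∀ y ∈ closedBall (0 : E) R,
      ‖φ (t, y) - φ (t, x) - L t x (y - x)‖ ≤ C * ‖y - x‖ ^ 2 := by
  obtain ⟨M, hM⟩ := h.bounded T R
  have hf' : ContDiff ℝ ∞ (fderiv ℝ f) := h.smooth.fderiv_right (by norm_cast)
  obtain ⟨K₁, hK₁0, hK₁⟩ := exists_bound_closedBall (h.smooth.continuous_fderiv (by simp)) M
  obtain ⟨K₂, hK₂0, hK₂⟩ := exists_bound_closedBall (hf'.continuous_fderiv (by simp)) M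
  refine ⟨K₂ * Real.exp (K₁ * T) ^ 2 * T * Real.exp (K₁ * T), fun t ht x hx y hy => ?_⟩
  have hd : ∀ s ∈ Icc (-T) T, ‖φ (s, y) - φ (s, x)‖ ≤ ‖y - x‖ * Real.exp (K₁ * T) :=
    fun s hs => h.norm_sub_le hK₁0 hK₁ (fun s hs => hM s hs x hx) (fun s hs => hM s hs y hy) hs
  have := norm_le_exp_of_norm_deriv_le
    (w := fun t => φ (t, y) - φ (t, x) - L t x (y - x))
    (δ := K₂ * (‖y - x‖ * Real.exp (K₁ * T)) ^ 2) hK₁0 (by positivity)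
    (fun s _ => ((h.hasDerivAt s y).sub (h.hasDerivAt s x)).sub
      ((hL.hasDerivAt s x).clm_apply (hasDerivAt_const s (y - x))))
    (fun s hs => by
      have ha : φ (s, x) ∈ closedBall (0 : E) M := by simpa using hM s hs x hx
      have hb : φ (s, y) ∈ closedBall (0 : E) M := by simpa using hM s hs y hy
      have e : f (φ (s, y)) - f (φ (s, x)) - (((fderiv ℝ f (φ (s, x))).comp (L s x)) (y - x)
          + L s x 0) = fderiv ℝ f (φ (s, x)) (φ (s, y) - φ (s, x) - L s x (y - x))
          + (f (φ (s, y)) - f (φ (s, x)) - fderiv ℝ f (φ (s, x)) (φ (s, y) - φ (s, x))) := by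
        simp only [ContinuousLinearMap.comp_apply, map_sub, map_zero]
        abel
      rw [e]
      refine (norm_add_le _ _).trans (add_le_add ?_ ?_)
      · exact (ContinuousLinearMap.le_opNorm _ _).trans (by gcongr; exact hK₁ _ ha)
      · refine (norm_taylor_le (convex_closedBall (0 : E) M) h.smooth hK₂ ha hb).trans ?_
        gcongr
        exact hd s hs) ht
  refine this.trans (le_of_eq ?_)
  simp only [h.init, hL.init, ContinuousLinearMap.id_apply, sub_self, norm_zero]
  ring

/-- The error splits into the spatial error at the new time, quadratic uniformly in time, the
variation of `L` in time applied to the spatial increment, and the error of the time derivative at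
fixed `x`. Only continuity of `L` in time is used. -/
theorem IsGlobalFlow.hasFDerivAt (h : IsGlobalFlow f φ) (hL : IsLinearizedFlow f φ L)
    (p : ℝ × E) : HasFDerivAt φ ((ContinuousLinearMap.fst ℝ ℝ E).smulRight (f (φ p))
      + (L p.1 p.2).comp (ContinuousLinearMap.snd ℝ ℝ E)) p := by
  obtain ⟨t, x⟩ := p
  have hfst : (fun q : ℝ × E => q.1 - t) =O[𝓝 (t, x)] fun q => q - (t, x) :=
    isBigO_of_le _ fun q => norm_fst_le (q - (t, x))
  have hsnd : (fun q : ℝ × E => q.2 - x) =O[𝓝 (t, x)] fun q => q - (t, x) :=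
    isBigO_of_le _ fun q => norm_snd_le (q - (t, x))
  have h0 : Tendsto (fun q : ℝ × E => q - (t, x)) (𝓝 (t, x)) (𝓝 0) := by
    have : Continuous fun q : ℝ × E => q - (t, x) := by fun_prop
    simpa using this.tendsto (t, x)
  have h1 : (fun q : ℝ × E => φ q - φ (q.1, x) - L q.1 x (q.2 - x)) =o[𝓝 (t, x)]
      fun q => q - (t, x) := by
    obtain ⟨C, hC⟩ := h.exists_quadratic_bound hL (|t| + 1) (‖x‖ + 1)
    have hO : (fun q : ℝ × E => φ q - φ (q.1, x) - L q.1 x (q.2 - x)) =O[𝓝 (t, x)]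
        fun q => ‖q - (t, x)‖ ^ 2 := by
      refine IsBigO.of_bound |C| ?_
      filter_upwards [closedBall_mem_nhds (t, x) one_pos] with q hq
      rw [mem_closedBall, dist_eq_norm] at hq
      have hq1 : |q.1 - t| ≤ 1 := (norm_fst_le (q - (t, x))).trans hq
      have hq2 : ‖q.2 - x‖ ≤ ‖q - (t, x)‖ := norm_snd_le (q - (t, x))
      have k1 : |q.1| ≤ |t| + 1 := by
        have := abs_sub_abs_le_abs_sub q.1 t
        linarith
      have k2 : ‖q.2‖ ≤ ‖x‖ + 1 := by
        have := norm_sub_norm_le q.2 x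
        linarith
      refine (hC q.1 (abs_le.1 k1) x (by simp) q.2 (by simpa using k2)).trans ?_
      rw [norm_pow, norm_norm]
      calc C * ‖q.2 - x‖ ^ 2 ≤ |C| * ‖q.2 - x‖ ^ 2 := by gcongr; exact le_abs_self C
        _ ≤ _ := by gcongr
    refine hO.trans_isLittleO ?_
    have h2 : (fun q : ℝ × E => ‖q - (t, x)‖ ^ 2) =o[𝓝 (t, x)] fun q => ‖q - (t, x)‖ := by
      simp only [pow_two]
      have h3 : (fun q : ℝ × E => ‖q - (t, x)‖) =o[𝓝 (t, x)] fun _ => (1 : ℝ) :=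
        (isLittleO_one_iff ℝ).2 (by simpa using h0.norm)
      simpa using h3.mul_isBigO (isBigO_refl (fun q : ℝ × E => ‖q - (t, x)‖) (𝓝 (t, x)))
    exact h2.of_norm_right
  have h2 : (fun q : ℝ × E => (L q.1 x - L t x) (q.2 - x)) =o[𝓝 (t, x)] fun q => q - (t, x) := by
    have hc : Tendsto (fun q : ℝ × E => L q.1 x - L t x) (𝓝 (t, x)) (𝓝 0) := by
      have h3 : Tendsto (fun q : ℝ × E => L q.1 x) (𝓝 (t, x)) (𝓝 (L t x)) :=
        (hL.hasDerivAt t x).continuousAt.tendsto.comp (continuous_fst.tendsto (t, x))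
      simpa using h3.sub_const (L t x)
    have h4 : (fun q : ℝ × E => ‖L q.1 x - L t x‖ * ‖q.2 - x‖) =o[𝓝 (t, x)]
        fun q => (1 : ℝ) * ‖q - (t, x)‖ :=
      ((isLittleO_one_iff ℝ).2 (by simpa using hc.norm)).mul_isBigO hsnd.norm_norm
    simp only [one_mul] at h4
    exact (isBigO_of_le _ fun q => by
      rw [norm_mul, norm_norm, norm_norm]
      exact ContinuousLinearMap.le_opNorm _ _).trans_isLittleO h4.of_norm_right
  have h3 : (fun q : ℝ × E => φ (q.1, x) - φ (t, x) - (q.1 - t) • f (φ (t, x))) =o[𝓝 (t, x)]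
      fun q => q - (t, x) := by
    have := (hasDerivAt_iff_isLittleO.1 (h.hasDerivAt t x)).comp_tendsto
      (continuous_fst.tendsto (t, x))
    exact this.trans_isBigO hfst
  rw [hasFDerivAt_iff_isLittleO]
  refine ((h1.add h2).add h3).congr_left fun q => ?_
  simp only [sub_apply, add_apply,
    ContinuousLinearMap.smulRight_apply, ContinuousLinearMap.comp_apply,
    ContinuousLinearMap.coe_fst', ContinuousLinearMap.coe_snd', Prod.fst_sub, Prod.snd_sub]
  abel

/-- The tangent lift of a global flow is a global flow. -/
theorem IsGlobalFlow.lift (h : IsGlobalFlow f φ) (hL : IsLinearizedFlow f φ L) :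
    IsGlobalFlow (fun p : E × E => (f p.1, fderiv ℝ f p.1 p.2))
      (fun q : ℝ × E × E => (φ (q.1, q.2.1), L q.1 q.2.1 q.2.2)) where
  smooth := by
    have hf' : ContDiff ℝ ∞ (fderiv ℝ f) := h.smooth.fderiv_right (by norm_cast)
    exact (h.smooth.comp contDiff_fst).prodMk ((hf'.comp contDiff_fst).clm_apply contDiff_snd)
  init x := by simp [h.init, hL.init]
  hasDerivAt t x := by
    have h1 := (hL.hasDerivAt t x.1).clm_apply (hasDerivAt_const t x.2)
    simp only [map_zero, add_zero] at h1
    exact (h.hasDerivAt t x.1).prodMk h1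
  bounded T R := by
    obtain ⟨M, hM⟩ := h.bounded T R
    obtain ⟨K, hK0, hK⟩ := exists_bound_closedBall (h.smooth.continuous_fderiv (by simp)) M
    -- The fibre component is linear in the initial vector, with operator norm at most `exp (K *
    -- T)`.
    refine ⟨max M (Real.exp (K * T) * R), fun t ht x hx => ?_⟩
    rw [mem_closedBall, dist_zero_right] at hx
    have hx1 : ‖x.1‖ ≤ R := (norm_fst_le x).trans hx
    have hx2 : ‖x.2‖ ≤ R := (norm_snd_le x).trans hx
    refine max_le_max (hM t ht _ (by simpa using hx1)) ?_
    refine (ContinuousLinearMap.le_opNorm _ _).trans ?_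
    gcongr
    exact hL.norm_le hK0 hK (fun s hs => hM s hs x.1 (by simpa using hx1)) ht

end SmoothFlow

/-! ### Smooth dependence on time and initial value, and existence of global flows. -/

section SmoothFlowInduction

universe u

/-- The derivative of `φ` is expressed by `f ∘ φ` and `L`, and `L` is a component of the lifted
flow. The induction therefore runs over all spaces at once: order `k` on `E × E` gives order `k + 1`
on `E`. -/
theorem IsGlobalFlow.contDiff_nat {E : Type u} [NormedAddCommGroup E] [NormedSpace ℝ E]
    [FiniteDimensional ℝ E] {f : E → E} {φ : ℝ × E → E} (h : IsGlobalFlow f φ) :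
    (k : ℕ) → ContDiff ℝ k φ
  | 0 => by
    obtain ⟨L, hL⟩ := h.exists_linearizedFlow
    exact contDiff_zero.2 (continuous_iff_continuousAt.2 fun p => (h.hasFDerivAt hL p).continuousAt)
  | k + 1 => by
    obtain ⟨L, hL⟩ := h.exists_linearizedFlow
    have h1 := h.contDiff_nat k
    have h2 := (h.lift hL).contDiff_nat k
    rw [Nat.cast_add, Nat.cast_one, contDiff_succ_iff_fderiv]
    refine ⟨fun p => (h.hasFDerivAt hL p).differentiableAt, by simp, ?_⟩
    rw [contDiff_clm_apply_iff]
    intro y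
    have e : (fun p => fderiv ℝ φ p y) = fun p : ℝ × E => y.1 • f (φ p) + L p.1 p.2 y.2 := by
      funext p
      rw [(h.hasFDerivAt hL p).fderiv]
      simp
    rw [e]
    have h3 : ContDiff ℝ k fun p : ℝ × E => L p.1 p.2 y.2 :=
      contDiff_snd.comp (h2.comp (contDiff_fst.prodMk (contDiff_snd.prodMk contDiff_const)))
    exact (contDiff_const.smul ((h.smooth.of_le (by exact_mod_cast le_top)).comp h1)).add h3

variable {E : Type u} [NormedAddCommGroup E] [NormedSpace ℝ E] [FiniteDimensional ℝ E]
  {f : E → E} {φ : ℝ × E → E}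

theorem IsGlobalFlow.contDiff (h : IsGlobalFlow f φ) : ContDiff ℝ ∞ φ :=
  contDiff_infty.2 h.contDiff_nat

open Set Metric in
theorem isLinearGrowthField_of_contDiff (hf : ContDiff ℝ ∞ f) {C : ℝ} (hC : 0 ≤ C)
    (hg : ∀ x, ‖f x‖ ≤ C * (1 + ‖x‖)) : IsLinearGrowthField fun _ : ℝ => f where
  continuous_time _ := continuous_const
  lipschitz T R := by
    obtain ⟨K, hK0, hK⟩ := exists_bound_closedBall (hf.continuous_fderiv (by simp)) R
    exact ⟨⟨K, hK0⟩, fun _ _ => (convex_closedBall (0 : E) R).lipschitzOnWith_of_nnnorm_fderiv_le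
      (𝕜 := ℝ) (fun x _ => hf.differentiable (by simp) x) hK⟩
  growth _ := ⟨C, hC, fun _ _ => hg⟩

open Set Metric in
-- The bound involves `f` only through `C`, so it is shared by all members of a net with the same
-- growth constant.
theorem exists_globalFlow (hf : ContDiff ℝ ∞ f) {C : ℝ} (hC : 0 ≤ C)
    (hg : ∀ x, ‖f x‖ ≤ C * (1 + ‖x‖)) : ∃ φ : ℝ × E → E, IsGlobalFlow f φ ∧
      ∀ T, ∀ t ∈ Icc (-T) T, ∀ x, ‖φ (t, x)‖ ≤ (‖x‖ + C * T) * Real.exp (C * T) := by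
  have : CompleteSpace E := FiniteDimensional.complete ℝ E
  choose α h0 hα using (isLinearGrowthField_of_contDiff hf hC hg).exists_global
  have hb : ∀ T, ∀ t ∈ Icc (-T) T, ∀ x, ‖α x t‖ ≤ (‖x‖ + C * T) * Real.exp (C * T) :=
    fun T t ht x => by
      simpa [h0] using norm_le_of_linear_growth hC (fun t _ => hα x t) (fun t _ => hg _) ht
  refine ⟨fun p => α p.2 p.1, ⟨hf, h0, fun t x => hα x t, fun T R => ?_⟩, hb⟩
  refine ⟨(R + C * T) * Real.exp (C * T), fun t ht x hx => (hb T t ht x).trans ?_⟩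
  gcongr
  simpa using hx

end SmoothFlowInduction

end Colombeau

namespace Colombeau

/-! ### Nets that are moderate up to a finite order -/

section ModerateTo

variable {X Y Z : Type*}
  [NormedAddCommGroup X] [NormedSpace ℝ X]
  [NormedAddCommGroup Y] [NormedSpace ℝ Y]
  [NormedAddCommGroup Z] [NormedSpace ℝ Z]

/-- Nets of smooth maps whose derivatives up to order `n` satisfy moderate estimates. -/
structure IsModerateTo (n : ℕ) (u : Eps → X → Y) : Prop where
  smooth : ∀ ε, ContDiff ℝ ∞ (u ε)
  moderate : ∀ K : Set X, IsCompact K → ∃ N : ℕ, ∃ C : ℝ, 0 ≤ C ∧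
    ∀ᶠ ε in smallEps, ∀ k ≤ n, ∀ x ∈ K, ‖iteratedFDeriv ℝ k (u ε) x‖ ≤ C * ((ε : ℝ) ^ N)⁻¹

theorem inv_pow_le_inv_pow (ε : Eps) {M N : ℕ} (h : M ≤ N) :
    ((ε : ℝ) ^ M)⁻¹ ≤ ((ε : ℝ) ^ N)⁻¹ := by
  have e0 : (0 : ℝ) < ε := ε.2.1
  exact inv_anti₀ (by positivity) (pow_le_pow_of_le_one e0.le ε.2.2 h)

theorem inv_pow_nonneg (ε : Eps) (N : ℕ) : 0 ≤ ((ε : ℝ) ^ N)⁻¹ := by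
  have e0 : (0 : ℝ) < ε := ε.2.1
  positivity

theorem IsModerate.moderateTo {u : Eps → X → Y} (hu : IsModerate u) (n : ℕ) :
    IsModerateTo n u :=
  ⟨hu.smooth, fun _ hK => by
    obtain ⟨N, C, hC, h⟩ := hu.uniform hK n
    exact ⟨N, C, by linarith, h⟩⟩

theorem isModerate_of_forall_moderateTo {u : Eps → X → Y} (hu : ∀ n, IsModerateTo n u) :
    IsModerate u :=
  ⟨(hu 0).smooth, fun K hK k => by
    obtain ⟨N, C, _, h⟩ := (hu k).moderate K hK
    exact ⟨N, C, h.mono fun _ h => h k le_rfl⟩⟩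

theorem IsModerateTo.mono {m n : ℕ} {u : Eps → X → Y} (hu : IsModerateTo n u) (h : m ≤ n) :
    IsModerateTo m u :=
  ⟨hu.smooth, fun K hK => by
    obtain ⟨N, C, hC, hb⟩ := hu.moderate K hK
    exact ⟨N, C, hC, hb.mono fun _ hb k hk => hb k (hk.trans h)⟩⟩

theorem IsModerateTo.fderiv {n : ℕ} {u : Eps → X → Y} (hu : IsModerateTo (n + 1) u) :
    IsModerateTo n (fun ε => fderiv ℝ (u ε)) := by
  refine ⟨fun ε => (hu.smooth ε).fderiv_right (by norm_cast), fun K hK => ?_⟩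
  obtain ⟨N, C, hC, hb⟩ := hu.moderate K hK
  refine ⟨N, C, hC, hb.mono fun ε hb k hk x hx => ?_⟩
  rw [norm_iteratedFDeriv_fderiv]
  exact hb _ (by omega) x hx

theorem IsModerateTo.succ {n : ℕ} {u : Eps → X → Y} (hu : IsModerateTo 0 u)
    (hu' : IsModerateTo n (fun ε => _root_.fderiv ℝ (u ε))) : IsModerateTo (n + 1) u := by
  refine ⟨hu.smooth, fun K hK => ?_⟩
  obtain ⟨N, C, hC, hb⟩ := hu.moderate K hK
  obtain ⟨M, D, hD, hd⟩ := hu'.moderate K hK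
  refine ⟨N + M, C + D, by positivity, ?_⟩
  filter_upwards [hb, hd] with ε hb hd k hk x hx
  have i0 := inv_pow_nonneg ε
  rcases k with _ | k
  · calc _ ≤ C * ((ε : ℝ) ^ N)⁻¹ := hb 0 le_rfl x hx
      _ ≤ (C + D) * ((ε : ℝ) ^ (N + M))⁻¹ :=
        mul_le_mul (by linarith) (inv_pow_le_inv_pow ε (by omega)) (i0 _) (by positivity)
  · rw [← norm_iteratedFDeriv_fderiv]
    calc _ ≤ D * ((ε : ℝ) ^ M)⁻¹ := hd k (by omega) x hx
      _ ≤ (C + D) * ((ε : ℝ) ^ (N + M))⁻¹ :=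
        mul_le_mul (by linarith) (inv_pow_le_inv_pow ε (by omega)) (i0 _) (by positivity)

theorem IsModerateTo.clm {n : ℕ} {u : Eps → X → Y} (hu : IsModerateTo n u) (L : Y →L[ℝ] Z) :
    IsModerateTo n (fun ε x => L (u ε x)) := by
  refine ⟨fun ε => L.contDiff.comp (hu.smooth ε), fun K hK => ?_⟩
  obtain ⟨N, C, hC, hb⟩ := hu.moderate K hK
  refine ⟨N, ‖L‖ * C, by positivity, hb.mono fun ε hb k hk x hx => ?_⟩
  calc _ ≤ ‖L‖ * ‖iteratedFDeriv ℝ k (u ε) x‖ :=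
        L.norm_iteratedFDeriv_comp_left (hu.smooth ε).contDiffAt (by exact_mod_cast le_top)
    _ ≤ ‖L‖ * (C * ((ε : ℝ) ^ N)⁻¹) := by gcongr; exact hb k hk x hx
    _ = _ := by ring

theorem IsModerateTo.add {n : ℕ} {u v : Eps → X → Y} (hu : IsModerateTo n u)
    (hv : IsModerateTo n v) : IsModerateTo n (fun ε x => u ε x + v ε x) := by
  refine ⟨fun ε => (hu.smooth ε).add (hv.smooth ε), fun K hK => ?_⟩
  obtain ⟨N, C, hC, hb⟩ := hu.moderate K hK
  obtain ⟨M, D, hD, hd⟩ := hv.moderate K hK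
  refine ⟨N + M, C + D, by positivity, ?_⟩
  filter_upwards [hb, hd] with ε hb hd k hk x hx
  have hs : iteratedFDeriv ℝ k (fun x => u ε x + v ε x) x
      = iteratedFDeriv ℝ k (u ε) x + iteratedFDeriv ℝ k (v ε) x :=
    iteratedFDeriv_add_apply ((hu.smooth ε).of_le (by exact_mod_cast le_top)).contDiffAt
      ((hv.smooth ε).of_le (by exact_mod_cast le_top)).contDiffAt
  rw [hs, add_mul]
  refine (norm_add_le _ _).trans (add_le_add ?_ ?_)
  · exact (hb k hk x hx).trans
      (mul_le_mul_of_nonneg_left (inv_pow_le_inv_pow ε (by omega)) hC)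
  · exact (hd k hk x hx).trans
      (mul_le_mul_of_nonneg_left (inv_pow_le_inv_pow ε (by omega)) hD)

theorem IsModerateTo.clm_apply {n : ℕ} {a : Eps → X → Y →L[ℝ] Z} {u : Eps → X → Y}
    (ha : IsModerateTo n a) (hu : IsModerateTo n u) :
    IsModerateTo n (fun ε x => a ε x (u ε x)) := by
  refine ⟨fun ε => (ha.smooth ε).clm_apply (hu.smooth ε), fun K hK => ?_⟩
  obtain ⟨N, C, hC, hb⟩ := ha.moderate K hK
  obtain ⟨M, D, hD, hd⟩ := hu.moderate K hK
  -- Leibniz rule; `2 ^ n` bounds the sum of the binomial coefficients.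
  refine ⟨N + M, 2 ^ n * (C * D), by positivity, ?_⟩
  filter_upwards [hb, hd] with ε hb hd k hk x hx
  have i0 := inv_pow_nonneg ε
  refine (norm_iteratedFDeriv_clm_apply (ha.smooth ε) (hu.smooth ε) x
    (by exact_mod_cast le_top)).trans ?_
  calc _ ≤ ∑ i ∈ Finset.range (k + 1), (k.choose i : ℝ) *
        (C * D * ((ε : ℝ) ^ (N + M))⁻¹) := by
        refine Finset.sum_le_sum fun i hi => ?_
        rw [Finset.mem_range] at hi
        rw [mul_assoc]
        refine mul_le_mul_of_nonneg_left ?_ (Nat.cast_nonneg _)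
        refine (mul_le_mul (hb i (by omega) x hx) (hd (k - i) (by omega) x hx) (norm_nonneg _)
          (mul_nonneg hC (i0 _))).trans (le_of_eq ?_)
        rw [pow_add, mul_inv]
        ring
    _ = 2 ^ k * (C * D) * ((ε : ℝ) ^ (N + M))⁻¹ := by
        rw [← Finset.sum_mul, ← Nat.cast_sum, Nat.sum_range_choose]
        push_cast
        ring
    _ ≤ _ := by
        refine mul_le_mul_of_nonneg_right ?_ (i0 _)
        refine mul_le_mul_of_nonneg_right ?_ (by positivity)
        exact pow_le_pow_right₀ one_le_two hk

theorem IsModerateTo.comp {n : ℕ} {f : Eps → Y → Z} {u : Eps → X → Y} (hf : IsModerate f)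
    (hu : IsModerateTo n u) (hb : IsCBoundedNet u) :
    IsModerateTo n (fun ε x => f ε (u ε x)) := by
  refine ⟨fun ε => (hf.smooth ε).comp (hu.smooth ε), fun K hK => ?_⟩
  obtain ⟨K', hK', hm⟩ := hb K hK
  obtain ⟨N, C, hC1, hC⟩ := hf.uniform hK' n
  obtain ⟨M, D, hD0, hD⟩ := hu.moderate K hK
  -- Using `1 + D` makes the base at least `1`, so that its `k`-th power is bounded by its `n`-th
  -- for all `k ≤ n`.
  refine ⟨N + M * n, n.factorial * C * (1 + D) ^ n, by positivity, ?_⟩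
  filter_upwards [hm, hC, hD] with ε h0 h1 h2 k hk x hx
  have e0 : (0 : ℝ) < ε := ε.2.1
  have e1 : (ε : ℝ) ≤ 1 := ε.2.2
  have i0 := inv_pow_nonneg ε
  have hi : 1 ≤ ((ε : ℝ) ^ M)⁻¹ := (one_le_inv₀ (by positivity)).2 (pow_le_one₀ e0.le e1)
  have hge : 1 ≤ (1 + D) * ((ε : ℝ) ^ M)⁻¹ := one_le_mul_of_one_le_of_one_le (by linarith) hi
  have key := norm_iteratedFDeriv_comp_le (n := k) (N := (∞ : WithTop ℕ∞)) (hf.smooth ε)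
    (hu.smooth ε) (by exact_mod_cast le_top) x
    (C := C * ((ε : ℝ) ^ N)⁻¹) (D := (1 + D) * ((ε : ℝ) ^ M)⁻¹)
    (fun i hi => h1 i (hi.trans hk) _ (h0 x hx))
    (fun i hi hik => ((h2 i (hik.trans hk) x hx).trans
      (mul_le_mul_of_nonneg_right (by linarith) (i0 _))).trans (le_self_pow₀ hge (by omega)))
  refine key.trans ?_
  calc _ ≤ (n.factorial : ℝ) * (C * ((ε : ℝ) ^ N)⁻¹) * ((1 + D) * ((ε : ℝ) ^ M)⁻¹) ^ n := by
        have := mul_nonneg (zero_le_one.trans hC1) (i0 N)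
        refine mul_le_mul ?_ (pow_le_pow_right₀ hge hk) (by positivity) (by positivity)
        gcongr
    _ = _ := by
        rw [mul_pow, inv_pow, ← pow_mul, pow_add, mul_inv]
        ring

/-- Nets of `L^∞`-log-type: on compact sets they are `O(|log ε|)`. -/
def IsLogType (a : Eps → X → Y) : Prop :=
  ∀ K : Set X, IsCompact K → ∃ C : ℝ, ∀ᶠ ε in smallEps, ∀ x ∈ K, ‖a ε x‖ ≤ C * |Real.log (ε : ℝ)|

theorem IsLogType.comp {a : Eps → Y → Z} {u : Eps → X → Y} (ha : IsLogType a)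
    (hu : IsCBoundedNet u) : IsLogType (fun ε x => a ε (u ε x)) := by
  intro K hK
  obtain ⟨A, hA, hA'⟩ := hu K hK
  obtain ⟨C, hC⟩ := ha A hA
  refine ⟨C, ?_⟩
  filter_upwards [hA', hC] with ε h1 h2 x hx
  exact h2 _ (h1 x hx)

/-- Since `ε ≤ 1`, the left side is `ε` to the power `-c`. This turns Grönwall factors of log-type
into moderate ones. -/
theorem exists_exp_mul_abs_log_le (c : ℝ) :
    ∃ N : ℕ, ∀ ε : Eps, Real.exp (c * |Real.log (ε : ℝ)|) ≤ ((ε : ℝ) ^ N)⁻¹ := by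
  refine ⟨⌈c⌉₊, fun ε => ?_⟩
  have e0 : (0 : ℝ) < ε := ε.2.1
  have hl : Real.log (ε : ℝ) ≤ 0 := Real.log_nonpos e0.le ε.2.2
  have h : ((ε : ℝ) ^ ⌈c⌉₊)⁻¹ = Real.exp (⌈c⌉₊ * |Real.log (ε : ℝ)|) := by
    rw [abs_of_nonpos hl, mul_neg, Real.exp_neg, Real.exp_nat_mul, Real.exp_log e0]
  rw [h, Real.exp_le_exp]
  exact mul_le_mul_of_nonneg_right (Nat.le_ceil c) (abs_nonneg _)

/-- Every compact subset of `ℝ × X` is contained in a compact cylinder. -/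
theorem exists_compact_cylinder {K : Set (ℝ × X)} (hK : IsCompact K) :
    ∃ T : ℝ, 0 ≤ T ∧ ∃ K' : Set X, IsCompact K' ∧ K ⊆ Set.Icc (-T) T ×ˢ K' := by
  obtain ⟨T, hT⟩ := (hK.image continuous_fst).exists_bound_of_continuousOn continuousOn_id
  refine ⟨max T 0, le_max_right _ _, Prod.snd '' K, hK.image continuous_snd,
    fun p hp => ⟨?_, p, hp, rfl⟩⟩
  exact abs_le.1 ((hT p.1 ⟨p, hp, rfl⟩).trans (le_max_left _ _))

/-- Time derivatives commute with spatial derivatives. -/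
theorem hasDerivAt_fderiv_comp_inr {w G : ℝ × X → Y} (hw : ContDiff ℝ ∞ w)
    (h : ∀ t x, HasDerivAt (fun s => w (s, x)) (G (t, x)) t) (t : ℝ) (x : X) :
    HasDerivAt (fun s => (fderiv ℝ w (s, x)).comp (ContinuousLinearMap.inr ℝ ℝ X))
      ((fderiv ℝ G (t, x)).comp (ContinuousLinearMap.inr ℝ ℝ X)) t := by
  have hw' : ContDiff ℝ ∞ (fderiv ℝ w) := hw.fderiv_right (by norm_cast)
  have hpath : ∀ s, HasDerivAt (fun s : ℝ => (s, x)) ((1 : ℝ), (0 : X)) s := fun s =>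
    (hasDerivAt_id s).prodMk (hasDerivAt_const s x)
  have hG : G = fun p => fderiv ℝ w p (1, 0) := by
    funext p
    have h1 := (hw.differentiable (by simp) p).hasFDerivAt
    have h2 : HasDerivAt (fun s : ℝ => (s, p.2)) ((1 : ℝ), (0 : X)) p.1 :=
      (hasDerivAt_id p.1).prodMk (hasDerivAt_const p.1 p.2)
    exact (h p.1 p.2).unique (HasFDerivAt.comp_hasDerivAt p.1 h1 h2)
  have h2 := (hw'.differentiable (by simp) (t, x)).hasFDerivAt
  have h3 := (((ContinuousLinearMap.compL ℝ X (ℝ × X) Y).flip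
    (ContinuousLinearMap.inr ℝ ℝ X)).hasFDerivAt.comp _ h2).comp_hasDerivAt t (hpath t)
  refine h3.congr_deriv (ContinuousLinearMap.ext fun y => ?_)
  -- `G` is the derivative of `w` in the direction `(1, 0)`, so the claim is the symmetry of the
  -- second derivative on `(1, 0)` and `(0, y)`.
  have hsymm : IsSymmSndFDerivAt ℝ w (t, x) := hw.contDiffAt.isSymmSndFDerivAt (by
    rw [minSmoothness_of_isRCLikeNormedField]
    exact WithTop.coe_le_coe.2 le_top)
  have h4 : fderiv ℝ G (t, x) = (ContinuousLinearMap.apply ℝ Y ((1 : ℝ), (0 : X))).comp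
      (fderiv ℝ (fderiv ℝ w) (t, x)) := by
    rw [hG]
    exact ((ContinuousLinearMap.apply ℝ Y ((1 : ℝ), (0 : X))).hasFDerivAt.comp _ h2).fderiv
  rw [h4]
  simpa using hsymm.eq (1, 0) (0, y)

/-- The full derivative is assembled from the time derivative `G`, which the equation controls, and
the spatial derivative. Only the latter needs an estimate of its own. -/
theorem IsModerateTo.of_partial {n : ℕ} {w G : Eps → ℝ × X → Y} (h0 : IsModerateTo 0 w)
    (hG : IsModerateTo n G) (h : ∀ ε t x, HasDerivAt (fun s => w ε (s, x)) (G ε (t, x)) t)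
    (hx : IsModerateTo n fun ε p => (_root_.fderiv ℝ (w ε) p).comp
      (ContinuousLinearMap.inr ℝ ℝ X)) : IsModerateTo (n + 1) w := by
  refine h0.succ ?_
  have h1 := (hG.clm (ContinuousLinearMap.smulRightL ℝ (ℝ × X) Y
    (ContinuousLinearMap.fst ℝ ℝ X))).add
    (hx.clm ((ContinuousLinearMap.compL ℝ (ℝ × X) X Y).flip (ContinuousLinearMap.snd ℝ ℝ X)))
  convert h1 using 3 with ε p
  have h2 := ((h0.smooth ε).differentiable (by simp) p).hasFDerivAt
  have h3 : HasDerivAt (fun s : ℝ => (s, p.2)) ((1 : ℝ), (0 : X)) p.1 :=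
    (hasDerivAt_id p.1).prodMk (hasDerivAt_const p.1 p.2)
  have h4 : G ε p = _root_.fderiv ℝ (w ε) p (1, 0) :=
    (h ε p.1 p.2).unique (HasFDerivAt.comp_hasDerivAt p.1 h2 h3)
  refine ContinuousLinearMap.ext fun q => ?_
  have hq : q = q.1 • ((1 : ℝ), (0 : X)) + (0, q.2) := by
    ext <;> simp
  rw [h4]
  conv_lhs => rw [hq, map_add, map_smul]
  simp

theorem isModerateTo_zero_of_linear_ode {A : Eps → ℝ × X → Y →L[ℝ] Y} {B w : Eps → ℝ × X → Y}
    (hA : IsLogType A) (hB : IsModerateTo 0 B) (hw : ∀ ε, ContDiff ℝ ∞ (w ε))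
    (h0 : IsModerateTo 0 fun ε x => w ε (0, x))
    (h : ∀ ε t x, HasDerivAt (fun s => w ε (s, x)) (A ε (t, x) (w ε (t, x)) + B ε (t, x)) t) :
    IsModerateTo 0 w := by
  refine ⟨hw, fun K hK => ?_⟩
  obtain ⟨T, hT, K', hK', hsub⟩ := exists_compact_cylinder hK
  have hc : IsCompact (Set.Icc (-T) T ×ˢ K') := isCompact_Icc.prod hK'
  obtain ⟨a, ha⟩ := hA _ hc
  obtain ⟨M, b, hb0, hb⟩ := hB.moderate _ hc
  obtain ⟨N, c, hc0, hc⟩ := h0.moderate _ hK'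
  obtain ⟨P, hP⟩ := exists_exp_mul_abs_log_le (|a| * T)
  -- The exponents come from the initial value (`N`), the inhomogeneity (`M`) and the Grönwall
  -- factor (`P`).
  refine ⟨N + M + P, c + b * T, by positivity, ?_⟩
  filter_upwards [ha, hb, hc] with ε ha hb hc k hk p hp
  obtain rfl : k = 0 := by omega
  rw [norm_iteratedFDeriv_zero]
  have i0 := inv_pow_nonneg ε
  obtain ⟨hp1, hp2⟩ := hsub hp
  have key := norm_le_exp_of_norm_deriv_le (w := fun t => w ε (t, p.2))
    (K := |a| * |Real.log (ε : ℝ)|) (δ := b * ((ε : ℝ) ^ M)⁻¹) (by positivity)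
    (mul_nonneg hb0 (i0 M)) (fun s _ => h ε s p.2)
    (fun s hs => by
      refine (norm_add_le _ _).trans (add_le_add ?_ ?_)
      · refine (ContinuousLinearMap.le_opNorm _ _).trans ?_
        refine mul_le_mul_of_nonneg_right ?_ (norm_nonneg _)
        refine (ha (s, p.2) ⟨hs, hp2⟩).trans ?_
        gcongr
        exact le_abs_self a
      · simpa using hb 0 le_rfl (s, p.2) ⟨hs, hp2⟩) hp1
  have hc' := hc 0 le_rfl p.2 hp2
  rw [norm_iteratedFDeriv_zero] at hc'
  refine key.trans ?_
  calc _ ≤ (c * ((ε : ℝ) ^ N)⁻¹ + b * ((ε : ℝ) ^ M)⁻¹ * T) * ((ε : ℝ) ^ P)⁻¹ := by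
        have h1 := hP ε
        rw [mul_right_comm] at h1
        have := mul_nonneg (mul_nonneg hb0 (i0 M)) hT
        have := mul_nonneg hc0 (i0 N)
        gcongr
    _ ≤ (c * ((ε : ℝ) ^ (N + M))⁻¹ + b * ((ε : ℝ) ^ (N + M))⁻¹ * T) * ((ε : ℝ) ^ P)⁻¹ := by
        have h1 := inv_pow_le_inv_pow ε (Nat.le_add_right N M)
        have h2 := inv_pow_le_inv_pow ε (Nat.le_add_left M N)
        have := i0 P
        gcongr
    _ = _ := by
        rw [pow_add _ (N + M) P, mul_inv]
        ring

end ModerateTo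

/-! ### Linear equations with coefficients of log-type. -/

section LinearODE

universe u v

variable {X : Type u} [NormedAddCommGroup X] [NormedSpace ℝ X]

/-- Solutions of linear equations with coefficients of log-type are moderate. -/
theorem isModerateTo_of_linear_ode {Y : Type (max u v)} [NormedAddCommGroup Y] [NormedSpace ℝ Y]
    {A : Eps → ℝ × X → Y →L[ℝ] Y} {B w : Eps → ℝ × X → Y} (hAl : IsLogType A)
    (hw : ∀ ε, ContDiff ℝ ∞ (w ε))
    (h : ∀ ε t x, HasDerivAt (fun s => w ε (s, x)) (A ε (t, x) (w ε (t, x)) + B ε (t, x)) t) :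
    (n : ℕ) → IsModerateTo n A → IsModerateTo n B → (IsModerateTo n fun ε x => w ε (0, x)) →
      IsModerateTo n w
  | 0, _, hB, h0 => isModerateTo_zero_of_linear_ode hAl hB hw h0 h
  | n + 1, hA, hB, h0 => by
    have hn : n ≤ n + 1 := n.le_succ
    have hwn := isModerateTo_of_linear_ode hAl hw h n (hA.mono hn) (hB.mono hn) (h0.mono hn)
    have hw0 := hwn.mono (Nat.zero_le n)
    refine IsModerateTo.of_partial hw0 (((hA.mono hn).clm_apply hwn).add (hB.mono hn)) h ?_
    have hflip : IsModerateTo n fun ε p => (fderiv ℝ (A ε) p).flip (w ε p) :=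
      (hA.fderiv.clm (ContinuousLinearMap.flipₗᵢ ℝ (ℝ × X) Y
        Y).toContinuousLinearEquiv.toContinuousLinearMap).clm_apply hwn
    -- The spatial derivative of `w` solves an equation with coefficient `A` acting by composition
    -- and a source built from the spatial derivatives of `A` and `B` and from `w`, all controlled
    -- to order `n`. Derivatives of `A` enter only the source, so they need only be moderate. The
    -- values now lie in `X →L[ℝ] Y`, which `Type (max u v)` accommodates.
    refine isModerateTo_of_linear_ode
      (A := fun ε p => ContinuousLinearMap.compL ℝ X Y Y (A ε p))
      (B := fun ε p => (ContinuousLinearMap.compL ℝ X (ℝ × X) Y).flip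
        (ContinuousLinearMap.inr ℝ ℝ X) ((fderiv ℝ (A ε) p).flip (w ε p) + fderiv ℝ (B ε) p))
      ?_ ?_ ?_ n ((hA.mono hn).clm _) ((hflip.add hB.fderiv).clm _) ?_
    · intro K hK
      obtain ⟨C, hC⟩ := hAl K hK
      refine ⟨C, hC.mono fun ε hC p hp => le_trans ?_ (hC p hp)⟩
      exact ContinuousLinearMap.opNorm_le_bound _ (norm_nonneg _) fun L =>
        ContinuousLinearMap.opNorm_comp_le _ _
    · exact fun ε => ((ContinuousLinearMap.compL ℝ X (ℝ × X) Y).flip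
        (ContinuousLinearMap.inr ℝ ℝ X)).contDiff.comp ((hw ε).fderiv_right (by norm_cast))
    · intro ε t x
      refine (hasDerivAt_fderiv_comp_inr (hw ε) (G := fun p => A ε p (w ε p) + B ε p)
        (h ε) t x).congr_deriv ?_
      have h1 := ((hA.smooth ε).differentiable (by simp) (t, x)).hasFDerivAt
      have h2 := ((hw ε).differentiable (by simp) (t, x)).hasFDerivAt
      have h3 := ((hB.smooth ε).differentiable (by simp) (t, x)).hasFDerivAt
      have h4 : fderiv ℝ (fun p => A ε p (w ε p) + B ε p) (t, x) = _ :=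
        ((h1.clm_apply h2).add h3).fderiv
      rw [h4]
      refine ContinuousLinearMap.ext fun y => ?_
      simp [add_assoc]
    · convert h0.fderiv using 3 with ε x
      have h2 := ((hw ε).differentiable (by simp) (0, x)).hasFDerivAt
      exact (h2.comp x (hasFDerivAt_prodMk_right 0 x)).fderiv.symm

end LinearODE

/-! ### Moderateness of a net of classical flows. -/

section FlowNet

universe u

variable {E : Type u} [NormedAddCommGroup E] [NormedSpace ℝ E] [FiniteDimensional ℝ E]
  {f : Eps → E → E} {φ : Eps → ℝ × E → E}

/-- Induction on the order. The spatial derivative solves the variational equation, whose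
coefficient is of log-type because `φ` is c-bounded, and is moderate to order `n` by induction. The
time derivative is `f ∘ φ`. -/
theorem IsGlobalFlow.isModerate (hf : IsModerate f) (hl : IsLogType fun ε => fderiv ℝ (f ε))
    (hφ : ∀ ε, IsGlobalFlow (f ε) (φ ε)) (hb : IsCBoundedNet φ) : IsModerate φ := by
  refine isModerate_of_forall_moderateTo fun n => ?_
  have hsm : ∀ ε, ContDiff ℝ ∞ (φ ε) := fun ε => (hφ ε).contDiff
  have h0 : IsModerateTo 0 φ := by
    refine ⟨hsm, fun K hK => ?_⟩
    obtain ⟨K', hK', h⟩ := hb K hK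
    obtain ⟨C, hC⟩ := hK'.exists_bound_of_continuousOn continuousOn_id
    refine ⟨0, max C 0, le_max_right _ _, h.mono fun ε h k hk x hx => ?_⟩
    obtain rfl : k = 0 := by omega
    simpa using Or.inl (hC _ (h x hx))
  induction n with
  | zero => exact h0
  | succ n ih =>
    refine IsModerateTo.of_partial h0 (IsModerateTo.comp hf ih hb)
      (fun ε t x => (hφ ε).hasDerivAt t x) ?_
    have hA : IsModerateTo n fun ε p => fderiv ℝ (f ε) (φ ε p) := IsModerateTo.comp hf.fderiv ih hb
    have hA' : IsLogType fun ε p => fderiv ℝ (f ε) (φ ε p) := hl.comp hb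
    refine isModerateTo_of_linear_ode
      (A := fun ε p => ContinuousLinearMap.compL ℝ E E E (fderiv ℝ (f ε) (φ ε p)))
      (B := fun _ _ => 0) ?_ ?_ ?_ n (hA.clm _) ((isModerate_const contDiff_const).moderateTo n) ?_
    · intro K hK
      obtain ⟨C, hC⟩ := hA' K hK
      refine ⟨C, hC.mono fun ε hC p hp => le_trans ?_ (hC p hp)⟩
      exact ContinuousLinearMap.opNorm_le_bound _ (norm_nonneg _) fun L =>
        ContinuousLinearMap.opNorm_comp_le _ _
    · exact fun ε => ((ContinuousLinearMap.compL ℝ E (ℝ × E) E).flip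
        (ContinuousLinearMap.inr ℝ ℝ E)).contDiff.comp ((hsm ε).fderiv_right (by norm_cast))
    · intro ε t x
      refine (hasDerivAt_fderiv_comp_inr (hsm ε) (G := fun p => f ε (φ ε p))
        (fun t x => (hφ ε).hasDerivAt t x) t x).congr_deriv ?_
      have h1 := ((hf.smooth ε).differentiable (by simp) (φ ε (t, x))).hasFDerivAt
      have h2 := ((hsm ε).differentiable (by simp) (t, x)).hasFDerivAt
      have h3 : fderiv ℝ (fun p => f ε (φ ε p)) (t, x) = _ := (h1.comp _ h2).fderiv
      rw [h3, add_zero]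
      rfl
    -- The flow at time `0` is the identity, so the initial value is a constant net.
    · have : (fun (ε : Eps) (x : E) => (fderiv ℝ (φ ε) (0, x)).comp
          (ContinuousLinearMap.inr ℝ ℝ E)) = fun _ _ => ContinuousLinearMap.id ℝ E := by
        funext ε x
        have h2 := ((hsm ε).differentiable (by simp) (0, x)).hasFDerivAt
        have h3 : HasFDerivAt (fun y : E => φ ε (0, y)) _ x :=
          h2.comp x (hasFDerivAt_prodMk_right 0 x)
        refine h3.unique ?_
        simp only [(hφ ε).init]
        exact hasFDerivAt_id x
      rw [this]
      exact (isModerate_const contDiff_const).moderateTo n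

end FlowNet

end Colombeau

namespace Colombeau

/-! ### Generalized flows -/

section GeneralizedFlow

open Set Metric

universe u

/-- A class depends only on small `ε`. The zero map is inserted elsewhere since it satisfies every
bound required later, so classical flows exist for all `ε`. -/
theorem Gen.IsRep.exists_truncation {X Y : Type*} [NormedAddCommGroup X] [NormedSpace ℝ X]
    [NormedAddCommGroup Y] [NormedSpace ℝ Y] {F : Gen X Y} {f : Eps → X → Y} (hf : F.IsRep f)
    {p : Eps → Prop} (hp : ∀ᶠ ε in smallEps, p ε) :
    ∃ g : Eps → X → Y, F.IsRep g ∧ (∀ ε, (p ε ∧ g ε = f ε) ∨ g ε = fun _ => 0) ∧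
      ∀ᶠ ε in smallEps, g ε = f ε := by
  classical
  obtain ⟨hm, rfl⟩ := hf
  set g : Eps → X → Y := fun ε => if p ε then f ε else fun _ => 0 with hg
  have hgp : ∀ ε, p ε → g ε = f ε := fun ε h => if_pos h
  have hgn : ∀ ε, ¬ p ε → g ε = fun _ => 0 := fun ε h => if_neg h
  have hev : ∀ᶠ ε in smallEps, g ε = f ε := hp.mono hgp
  refine ⟨g, ⟨⟨fun ε => ?_, fun K hK k => ?_⟩, Quotient.sound' fun K hK m => ?_⟩, fun ε => ?_, hev⟩
  · by_cases h : p ε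
    · rw [hgp ε h]
      exact hm.smooth ε
    · rw [hgn ε h]
      exact contDiff_const
  · obtain ⟨N, C, hC⟩ := hm.moderate K hK k
    refine ⟨N, C, ?_⟩
    filter_upwards [hC, hev] with ε h1 h2
    rwa [h2]
  · refine ⟨0, ?_⟩
    filter_upwards [hev] with ε h x _
    simp [h]
  · by_cases h : p ε
    · exact Or.inl ⟨h, hgp ε h⟩
    · exact Or.inr (hgn ε h)

variable {E : Type u} [NormedAddCommGroup E] [NormedSpace ℝ E]

theorem HasLinearGrowthAndLogTypeGradient.exists_rep {F : Gen E E}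
    (hF : HasLinearGrowthAndLogTypeGradient F) : ∃ f : Eps → E → E, F.IsRep f ∧
      (∃ C : ℝ, 0 ≤ C ∧ ∀ ε x, ‖f ε x‖ ≤ C * (1 + ‖x‖)) ∧ IsLogType fun ε => fderiv ℝ (f ε) := by
  obtain ⟨f, hf, ⟨C, hC, hg⟩, hl⟩ := hF
  obtain ⟨g, hgr, hg1, hg2⟩ := hf.exists_truncation (eventually_smallEps.2 hg)
  refine ⟨g, hgr, ⟨C, hC.le, fun ε x => ?_⟩, fun K hK => ?_⟩
  · rcases hg1 ε with ⟨h, e⟩ | e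
    · rw [e]
      exact h x
    · rw [e, norm_zero]
      positivity
  · obtain ⟨D, hD⟩ := hl K hK
    refine ⟨D, ?_⟩
    filter_upwards [hD, hg2] with ε h e
    rwa [e]

theorem eventually_one_le_abs_log : ∀ᶠ ε : Eps in smallEps, 1 ≤ |Real.log (ε : ℝ)| := by
  refine eventually_smallEps.2 ⟨Real.exp (-1), Real.exp_pos _, fun ε hε => ?_⟩
  have h := Real.log_lt_log ε.2.1 hε
  rw [Real.log_exp] at h
  exact le_abs.2 (Or.inr (by linarith))

/-- The mean value inequality from the origin yields linear growth with the same constant. -/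
theorem HasBoundedGradient.exists_rep {F : Gen E E} (hF : HasBoundedGradient F) :
    ∃ f : Eps → E → E, F.IsRep f ∧ ∃ C : ℝ, 0 ≤ C ∧
      (∀ ε x, ‖f ε x‖ ≤ C * (1 + ‖x‖)) ∧ ∀ ε x, ‖fderiv ℝ (f ε) x‖ ≤ C := by
  obtain ⟨f, hf, C, hC, hg⟩ := hF
  obtain ⟨g, hgr, hg1, -⟩ := hf.exists_truncation (eventually_smallEps.2 hg)
  have hd : ∀ ε x, ‖fderiv ℝ (g ε) x‖ ≤ C := fun ε x => by
    rcases hg1 ε with ⟨h, e⟩ | e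
    · rw [e]
      exact h.2 x
    · rw [e]
      simpa using hC.le
  refine ⟨g, hgr, C, hC.le, fun ε x => ?_, hd⟩
  have h0 : ‖g ε 0‖ ≤ C := by
    rcases hg1 ε with ⟨h, e⟩ | e
    · rw [e]
      exact h.1
    · rw [e]
      simpa using hC.le
  have h1 := convex_univ.norm_image_sub_le_of_norm_fderiv_le (𝕜 := ℝ) (f := g ε)
    (fun z _ => (hgr.1.smooth ε).differentiable (by simp) z) (fun z _ => hd ε z) (mem_univ 0)
    (mem_univ x)
  rw [sub_zero] at h1
  have h2 := norm_sub_norm_le (g ε x) (g ε 0)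
  linarith

variable [FiniteDimensional ℝ E] {f : Eps → E → E} {φ : Eps → ℝ × E → E}

theorem exists_flow_net (hf : IsModerate f) {C : ℝ} (hC : 0 ≤ C)
    (hg : ∀ ε x, ‖f ε x‖ ≤ C * (1 + ‖x‖)) (hl : IsLogType fun ε => fderiv ℝ (f ε)) :
    ∃ φ : Eps → ℝ × E → E, (∀ ε, IsGlobalFlow (f ε) (φ ε)) ∧ IsModerate φ ∧ IsCBoundedNet φ := by
  have : ProperSpace E := FiniteDimensional.proper_real E
  choose φ hφ hb using fun ε => exists_globalFlow (hf.smooth ε) hC (hg ε)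
  have hcb : IsCBoundedNet φ := by
    intro K hK
    obtain ⟨T, hT, K', hK', hsub⟩ := exists_compact_cylinder hK
    obtain ⟨R, hR⟩ := hK'.isBounded.exists_norm_le
    refine ⟨closedBall 0 ((R + C * T) * Real.exp (C * T)), isCompact_closedBall _ _,
      Eventually.of_forall fun ε p hp => ?_⟩
    obtain ⟨h1, h2⟩ := hsub hp
    rw [mem_closedBall, dist_zero_right]
    refine (hb ε T p.1 h1 p.2).trans ?_
    have := hR p.2 h2
    gcongr
  exact ⟨φ, hφ, IsGlobalFlow.isModerate hf hl hφ hcb, hcb⟩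

/-- The three identities hold exactly for every `ε`, so the representatives themselves agree. -/
theorem isFlow_mk (hf : IsModerate f) (hφ : ∀ ε, IsGlobalFlow (f ε) (φ ε)) (hm : IsModerate φ)
    (hb : IsCBoundedNet φ) :
    IsFlow (Quotient.mk (genSetoid E E) ⟨f, hf⟩) (Quotient.mk (cbddSetoid (ℝ × E) E) ⟨φ, hm, hb⟩)
    where
  ode := congrArg (Quotient.mk (genSetoid (ℝ × E) E)) <| Subtype.ext <| by
    funext ε p
    exact ((hφ ε).hasDerivAt p.1 p.2).deriv
  initial := congrArg (Quotient.mk (cbddSetoid E E)) <| Subtype.ext <| by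
    funext ε x
    exact (hφ ε).init x
  group := congrArg (Quotient.mk (cbddSetoid (ℝ × ℝ × E) E)) <| Subtype.ext <| by
    funext ε p
    exact (hφ ε).add p.1 p.2.1 p.2.2

/-- Grönwall's inequality for the difference of the representatives. An estimate of order zero
suffices, as the difference is moderate. -/
theorem IsFlow.eq_mk (hf : IsModerate f) (hl : IsLogType fun ε => fderiv ℝ (f ε))
    (hφ : ∀ ε, IsGlobalFlow (f ε) (φ ε)) (hm : IsModerate φ) (hb : IsCBoundedNet φ)
    {Φ : CBdd (ℝ × E) E} (hΦ : IsFlow (Quotient.mk (genSetoid E E) ⟨f, hf⟩) Φ) :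
    Φ = Quotient.mk (cbddSetoid (ℝ × E) E) ⟨φ, hm, hb⟩ := by
  have : ProperSpace E := FiniteDimensional.proper_real E
  obtain ⟨⟨v, hvm, hvb⟩, rfl⟩ := Quotient.exists_rep Φ
  have hode : IsNegligible fun ε (p : ℝ × E) =>
      deriv (fun t => v ε (t, p.2)) p.1 - f ε (v ε p) := Quotient.exact hΦ.ode
  have hinit : IsNegligible fun ε (x : E) => v ε (0, x) - x :=
    IsNegligibleAllOrders.negligible (Quotient.exact hΦ.initial)
  refine Quotient.sound' (IsNegligible.allOrders (hvm.sub hm) fun K hK m => ?_)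
  obtain ⟨T, hT, K', hK', hsub⟩ := exists_compact_cylinder hK
  have hc : IsCompact (Icc (-T) T ×ˢ K') := isCompact_Icc.prod hK'
  obtain ⟨A, hA, hA'⟩ := hvb _ hc
  obtain ⟨B, hB, hB'⟩ := hb _ hc
  -- A ball containing both images is convex, so the gradient bound on it gives a Lipschitz bound.
  obtain ⟨R, hR⟩ := (hA.union hB).isBounded.subset_closedBall 0
  obtain ⟨a, ha⟩ := hl _ (isCompact_closedBall (0 : E) R)
  obtain ⟨P, hP⟩ := exists_exp_mul_abs_log_le (|a| * T)
  -- The `P` additional powers of `ε` pay for the Grönwall factor.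
  obtain ⟨C, hC⟩ := hode _ hc (m + P)
  obtain ⟨D, hD⟩ := hinit _ hK' (m + P)
  refine ⟨|D| + |C| * T, ?_⟩
  filter_upwards [hA', hB', ha, hC, hD] with ε h1 h2 h3 h4 h5 p hp
  obtain ⟨hp1, hp2⟩ := hsub hp
  have e0 : (0 : ℝ) < ε := ε.2.1
  have hv : ∀ s, HasDerivAt (fun t => v ε (t, p.2)) (deriv (fun t => v ε (t, p.2)) s) s :=
    fun s => DifferentiableAt.hasDerivAt
      (((hvm.smooth ε).differentiable (by simp) (s, p.2)).comp s
        ((differentiableAt_id).prodMk (differentiableAt_const p.2)))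
  have hlip : ∀ z ∈ closedBall (0 : E) R, ‖fderiv ℝ (f ε) z‖ ≤ |a| * |Real.log (ε : ℝ)| :=
    fun z hz => (h3 z hz).trans (by gcongr; exact le_abs_self a)
  have key := norm_le_exp_of_norm_deriv_le (w := fun t => v ε (t, p.2) - φ ε (t, p.2))
    (K := |a| * |Real.log (ε : ℝ)|) (δ := |C| * (ε : ℝ) ^ (m + P)) (by positivity)
    (by positivity) (fun s _ => (hv s).sub ((hφ ε).hasDerivAt s p.2))
    (fun s hs => by
      have k1 := hR (Or.inl (h1 (s, p.2) ⟨hs, hp2⟩))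
      have k2 := hR (Or.inr (h2 (s, p.2) ⟨hs, hp2⟩))
      have k3 := (convex_closedBall (0 : E) R).norm_image_sub_le_of_norm_fderiv_le (𝕜 := ℝ)
        (f := f ε) (fun z _ => (hf.smooth ε).differentiable (by simp) z) hlip k2 k1
      have k4 := (h4 (s, p.2) ⟨hs, hp2⟩).trans
        (mul_le_mul_of_nonneg_right (le_abs_self C) (by positivity))
      rw [add_comm, ← sub_add_sub_cancel _ (f ε (v ε (s, p.2)))]
      exact (norm_add_le _ _).trans (add_le_add k4 k3)) hp1
  rw [(hφ ε).init] at key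
  have k5 := (h5 p.2 hp2).trans (mul_le_mul_of_nonneg_right (le_abs_self D) (by positivity))
  calc ‖v ε p - φ ε p‖
      ≤ (|D| * (ε : ℝ) ^ (m + P) + |C| * (ε : ℝ) ^ (m + P) * T) * ((ε : ℝ) ^ P)⁻¹ := by
        refine key.trans ?_
        have k6 := hP ε
        rw [mul_right_comm] at k6
        gcongr
    _ = _ := by
        rw [pow_add]
        field_simp

/-- A vector field with a representative of linear growth and log-type gradient has a unique
generalized flow. -/
theorem existsUnique_isFlow {F : Gen E E} (hF : HasLinearGrowthAndLogTypeGradient F) :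
    ∃! Φ : CBdd (ℝ × E) E, IsFlow F Φ := by
  obtain ⟨f, ⟨hf, rfl⟩, ⟨C, hC, hg⟩, hl⟩ := hF.exists_rep
  obtain ⟨φ, hφ, hm, hb⟩ := exists_flow_net hf hC hg hl
  exact ⟨_, isFlow_mk hf hφ hm hb, fun Ψ hΨ => hΨ.eq_mk hf hl hφ hm hb⟩

/-- By the equation this derivative is `F` composed with `Φ`, and linear growth makes a
representative of `F` c-bounded. -/
theorem IsFlow.timeDeriv_isCBounded {F : Gen E E} (hF : HasLinearGrowthAndLogTypeGradient F)
    {Φ : CBdd (ℝ × E) E} (hΦ : IsFlow F Φ) : Φ.timeDeriv.IsCBounded := by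
  have : ProperSpace E := FiniteDimensional.proper_real E
  obtain ⟨f, ⟨hf, rfl⟩, ⟨C, hC, hg⟩, -⟩ := hF.exists_rep
  have hfb : IsCBoundedNet f := fun K hK => by
    obtain ⟨R, hR⟩ := hK.isBounded.exists_norm_le
    refine ⟨closedBall 0 (C * (1 + R)), isCompact_closedBall _ _,
      Eventually.of_forall fun ε x hx => ?_⟩
    rw [mem_closedBall, dist_zero_right]
    refine (hg ε x).trans ?_
    have := hR x hx
    gcongr
  rw [hΦ.ode]
  obtain ⟨⟨v, hvm, hvb⟩, rfl⟩ := Quotient.exists_rep Φ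
  exact ⟨Quotient.mk _ ⟨_, hf.comp hvm hvb, hfb.comp hvb⟩, rfl⟩

/-- The representative with bounded gradient also has linear growth and log-type gradient. Its
classical flows therefore represent `Φ` by uniqueness, and their linearizations are bounded by `exp
(C * T)`. -/
theorem IsFlow.spaceDeriv_isCBounded {F : Gen E E} (hF : HasBoundedGradient F)
    {Φ : CBdd (ℝ × E) E} (hΦ : IsFlow F Φ) : Φ.spaceDeriv.IsCBounded := by
  have : ProperSpace (E →L[ℝ] E) := FiniteDimensional.proper_real _
  obtain ⟨f, ⟨hf, rfl⟩, C, hC, hg, hd⟩ := hF.exists_rep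
  have hl : IsLogType fun ε => fderiv ℝ (f ε) := fun K _ => by
    refine ⟨C, eventually_one_le_abs_log.mono fun ε h x _ => (hd ε x).trans ?_⟩
    exact le_mul_of_one_le_right hC h
  obtain ⟨φ, hφ, hm, hb⟩ := exists_flow_net hf hC hg hl
  rw [hΦ.eq_mk hf hl hφ hm hb]
  refine ⟨Quotient.mk _ ⟨_, hm.spaceDeriv, fun K hK => ?_⟩, rfl⟩
  obtain ⟨T, hT, K', hK', hsub⟩ := exists_compact_cylinder hK
  obtain ⟨R, hR⟩ := hK'.isBounded.exists_norm_le
  refine ⟨closedBall 0 (Real.exp (C * T)), isCompact_closedBall _ _,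
    Eventually.of_forall fun ε p hp => ?_⟩
  obtain ⟨h1, h2⟩ := hsub hp
  obtain ⟨L, hL⟩ := (hφ ε).exists_linearizedFlow
  -- `M` may depend on `ε`: the gradient bound is global, so `M` does not enter the final estimate.
  obtain ⟨M, hM⟩ := (hφ ε).bounded T R
  have e : (((ContinuousLinearMap.fst ℝ ℝ E).smulRight (f ε (φ ε p))
      + (L p.1 p.2).comp (ContinuousLinearMap.snd ℝ ℝ E)).comp
      (ContinuousLinearMap.inr ℝ ℝ E)) = L p.1 p.2 := by
    ext
    simp
  rw [mem_closedBall, dist_zero_right, fderiv_snd_eq (hm.smooth ε) p,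
    ((hφ ε).hasFDerivAt hL p).fderiv, e]
  exact hL.norm_le hC (M := M) (fun x _ => hd ε x)
    (fun s hs => hM s hs p.2 (by simpa using hR p.2 h2)) h1

end GeneralizedFlow

end Colombeau

theorem theorem3p3 (n : ℕ)
    (F : Colombeau.Gen (EuclideanSpace ℝ (Fin n)) (EuclideanSpace ℝ (Fin n)))
    (hF : Colombeau.HasLinearGrowthAndLogTypeGradient F) :
    (∃! Φ : Colombeau.CBdd (ℝ × EuclideanSpace ℝ (Fin n)) (EuclideanSpace ℝ (Fin n)),
      Colombeau.IsFlow F Φ) ∧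
    ∀ Φ : Colombeau.CBdd (ℝ × EuclideanSpace ℝ (Fin n)) (EuclideanSpace ℝ (Fin n)),
      Colombeau.IsFlow F Φ →
        Φ.timeDeriv.IsCBounded ∧
        (Colombeau.HasBoundedGradient F → Φ.spaceDeriv.IsCBounded) :=
  ⟨Colombeau.existsUnique_isFlow hF, fun _ hΦ =>
    ⟨hΦ.timeDeriv_isCBounded hF, fun hB => hΦ.spaceDeriv_isCBounded hB⟩⟩
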